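/- Let $\mathcal H_S=\mathbb C^n$ with orthonormal energy eigenbasis $|\epsilon_i\rangle$ and $H_S=\sum_i\epsilon_i|\epsilon_i\rangle\langle\epsilon_i|$, $\epsilon_i\in\mathbb R$. Let $\mathcal H_W=L^2(\mathbb R)$ (wave functions $\psi(E)$), let $H_W$ be multiplication by $E$, and let $\Gamma_\epsilon=e^{-i\epsilon\Delta_W}$, $(\Gamma_\epsilon\psi)(E)=\psi(E-\epsilon)$, be the displacement operators, with generator $\Delta_W=-i\,d/dE$. Put $S=e^{-iH_S\otimes\Delta_W}=\sum_i|\epsilon_i\rangle\langle\epsilon_i|\otimes\Gamma_{\epsilon_i}$. Let $V_S$ be a unitary on $\mathcal H_S$ and let $U=S^\dagger V_SS$, which is the general form of a unitary that conserves $H_S+H_W$ and commutes with $\Delta_W$. Let $\rho=\rho_S\otimes\rho_W$ be a product of density operators with $\mathrm{Tr}[H_W^2\rho_W]<\infty$. Write $\langle A\rangle_\rho=\mathrm{Tr}[A\rho]$, $\mathrm{Cov}_\rho[A,B]=\frac12\langle AB+BA\rangle_\rho-\langle A\rangle_\rho\langle B\rangle_\rho$ (products of unbounded operators being understood as quadratic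 forms, $\langle\psi,AB\psi\rangle=\langle A\psi,B\psi\rangle$), $\mathrm{Var}_\rho[A]=\mathrm{Cov}_\rho[A,A]$, and $$\Delta E_W=\langle U^\dagger H_WU\rangle_\rho-\langle H_W\rangle_\rho,\qquad \Delta\sigma_W^2=\mathrm{Var}_\rho[U^\dagger H_WU]-\mathrm{Var}_\rho[H_W].$$ Let $W_S=H_S-V_S^\dagger H_SV_S$, $W_S(t)=e^{iH_St}W_Se^{-iH_St}$, let $\sigma=S\rho S^\dagger$ be the control state and $\sigma_S=\mathrm{Tr}_W[\sigma]$ the control-marginal state, let $$W(E,t)=\frac1{2\pi}\int d\omega\,e^{i\omega t}\,\langle E-\tfrac\omega2|\rho_W|E+\tfrac\omega2\rangle$$ be the Wigner function of the weight, and let $$\xi_S(s)=\frac{\int dt\int dE\,e^{iEs}\,W(E,t)\,e^{-iH_St}\rho_Se^{iH_St}}{\mathrm{Tr}[e^{iH_Ws}\rho_W]}.$$ Then all second moments below are finite, and $$\Delta E_W=\langle W_S\rangle_{\sigma_S},\qquad \Delta\sigma_W^2=\mathrm{Var}_{\sigma_S}[W_S]+2F,\qquad F=\mathrm{Cov}_\sigma[H_S-H_W,\,V_S^\dagger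 H_SV_S].$$ Moreover, $W(\cdot,t)$ is integrable for almost every $t$, the function $t\mapsto\int dE\,e^{iEs}W(E,t)$ is integrable for every $s$, $\xi_S$ is differentiable at $0$, and $$F=-i\,\mathrm{Tr}[W_S\,\xi_S'(0)].$$ Finally, if $E\mapsto(E-\langle H_W\rangle_\rho)\,W(E,t)$ is integrable for almost every $t$ (so that the inner integral below is defined), then the outer integrand is integrable and $$F=\int dt\,\mathrm{Tr}[W_S(t)\rho_S]\int dE\,\bigl[E-\langle H_W\rangle_\rho\bigr]\,W(E,t).$$ -/

import Mathlib

open MeasureTheory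
open scoped ComplexConjugate

noncomputable section

namespace QWeight

/-! ### Mixed states and (possibly unbounded) observables -/

/-- A density operator `ρ = ∑ₖ pₖ |ψₖ⟩⟨ψₖ|` on the Hilbert space `H`, given by a convex
decomposition into pure states (the spectral decomposition, or any other one; the `ψₖ` need not
be orthogonal). By `MixedState.exists_represents` every positive operator of trace one is of
this form. -/
structure MixedState (ι H : Type*) [NormedAddCommGroup H] [InnerProductSpace ℂ H] where
  p : ι → ℝ
  ψ : ι → H
  p_nonneg : ∀ k, 0 ≤ p k
  hasSum_p : HasSum p 1
  norm_ψ : ∀ k, ‖ψ k‖ = 1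

/-- The value of a partially defined operator, extended by `0` outside its domain. -/
def app {H : Type*} [NormedAddCommGroup H] [InnerProductSpace ℂ H]
    (A : H →ₗ.[ℂ] H) (x : H) : H :=
  open Classical in if h : x ∈ A.domain then A ⟨x, h⟩ else 0

/-- A bounded operator, as an everywhere defined unbounded operator. -/
def ofBounded {H : Type*} [NormedAddCommGroup H] [InnerProductSpace ℂ H]
    (T : H →L[ℂ] H) : H →ₗ.[ℂ] H :=
  (T : H →ₗ[ℂ] H).toPMap ⊤

/-- The operator `U† A U`, on the domain `{x | U x ∈ D(A)}`. -/
def heisenberg {H : Type*} [NormedAddCommGroup H] [InnerProductSpace ℂ H] [CompleteSpace H]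
    (U : H →L[ℂ] H) (A : H →ₗ.[ℂ] H) : H →ₗ.[ℂ] H where
  domain := A.domain.comap (U : H →ₗ[ℂ] H)
  toFun := (ContinuousLinearMap.adjoint U : H →ₗ[ℂ] H) ∘ₗ A.toFun ∘ₗ
    ((U : H →ₗ[ℂ] H).restrict (fun _ hx => hx))

namespace MixedState

variable {ι κ H : Type*} [NormedAddCommGroup H] [InnerProductSpace ℂ H]

/-- `T = ∑ₖ pₖ |ψₖ⟩⟨ψₖ|`, strongly convergent. -/
def Represents (ρ : MixedState ι H) (T : H →L[ℂ] H) : Prop :=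
  ∀ x, HasSum (fun k => (ρ.p k : ℂ) • inner ℂ (ρ.ψ k) x • ρ.ψ k) (T x)

/-- Every positive operator of trace one is represented by a mixed state. -/
theorem exists_represents [CompleteSpace H] (b : HilbertBasis ι ℂ H) (T : H →L[ℂ] H)
    (hT : T.IsPositive) (htr : HasSum (fun k => inner ℂ (b k) (T (b k))) 1) :
    ∃ ρ : MixedState ι H, ρ.Represents T := by
  classical
  have h0 : (0 : H →L[ℂ] H) ≤ T := (ContinuousLinearMap.nonneg_iff_isPositive T).2 hT
  set R : H →L[ℂ] H := CFC.sqrt T with hR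
  have hRR : R * R = T := CFC.sqrt_mul_sqrt_self T h0
  have hRsa : IsSelfAdjoint R := IsSelfAdjoint.of_nonneg (CFC.sqrt_nonneg T)
  have hsym : ∀ x y, inner ℂ (R x) y = inner ℂ x (R y) := fun x y => by
    rw [← ContinuousLinearMap.adjoint_inner_right, ContinuousLinearMap.isSelfAdjoint_iff'.1 hRsa]
  have hTR : ∀ x, T x = R (R x) := fun x => by rw [← hRR]; rfl
  have hin : ∀ k, inner ℂ (b k) (T (b k)) = ((‖R (b k)‖ ^ 2 : ℝ) : ℂ) := fun k => by
    rw [hTR, ← hsym, inner_self_eq_norm_sq_to_K]; push_cast; rfl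
  refine ⟨{ p := fun k => ‖R (b k)‖ ^ 2
            ψ := fun k => if R (b k) = 0 then b k else ((‖R (b k)‖⁻¹ : ℝ) : ℂ) • R (b k)
            p_nonneg := fun k => by positivity
            hasSum_p := ?_
            norm_ψ := fun k => ?_ }, fun x => ?_⟩
  · simp_rw [hin] at htr
    rw [← Complex.ofReal_one] at htr
    exact Complex.hasSum_ofReal.1 htr
  · split_ifs with h
    · exact b.orthonormal.1 k
    · rw [norm_smul, Complex.norm_real, norm_inv, norm_norm, inv_mul_cancel₀ (norm_ne_zero_iff.2 h)]
  · have hs := (b.hasSum_repr (R x)).mapL R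
    rw [← hTR] at hs
    convert hs using 1
    funext k
    rw [b.repr_apply_apply, ← hsym, map_smul]
    dsimp only
    split_ifs with h
    · simp [h]
    · have h' : (‖R (b k)‖ : ℂ) ≠ 0 := by exact_mod_cast norm_ne_zero_iff.2 h
      rw [inner_smul_left, smul_smul, smul_smul, Complex.conj_ofReal]
      congr 1
      push_cast
      field_simp

/-- The expectation `⟨A⟩_ρ = Tr[A ρ] = ∑ₖ pₖ ⟨ψₖ, A ψₖ⟩`. -/
def expect (ρ : MixedState ι H) (A : H →ₗ.[ℂ] H) : ℂ :=
  ∑' k, (ρ.p k : ℂ) * inner ℂ (ρ.ψ k) (app A (ρ.ψ k))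

/-- The covariance `½ ⟨A B + B A⟩_ρ - ⟨A⟩_ρ ⟨B⟩_ρ` of two symmetric operators. The products are
read as quadratic forms, `⟨ψ, A B ψ⟩ = ⟨A ψ, B ψ⟩`, so that for unbounded `A`, `B` only
`ψ ∈ D(A) ∩ D(B)` is needed. -/
def cov (ρ : MixedState ι H) (A B : H →ₗ.[ℂ] H) : ℂ :=
  (∑' k, (ρ.p k : ℂ) * ((1 / 2 : ℂ) *
      (inner ℂ (app A (ρ.ψ k)) (app B (ρ.ψ k)) + inner ℂ (app B (ρ.ψ k)) (app A (ρ.ψ k)))))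
    - ρ.expect A * ρ.expect B

/-- The variance `Var_ρ[A] = Cov_ρ[A, A]`. -/
def var (ρ : MixedState ι H) (A : H →ₗ.[ℂ] H) : ℂ := ρ.cov A A

/-- The observable `A` has a finite second moment `Tr[A² ρ] < ∞` in the state `ρ`. -/
def FiniteSecondMoment (ρ : MixedState ι H) (A : H →ₗ.[ℂ] H) : Prop :=
  (∀ k, ρ.p k ≠ 0 → ρ.ψ k ∈ A.domain) ∧ Summable fun k => ρ.p k * ‖app A (ρ.ψ k)‖ ^ 2

/-- The evolved state `S ρ S†`. -/
def map (ρ : MixedState ι H) (S : H ≃ₗᵢ[ℂ] H) : MixedState ι H where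
  p := ρ.p
  ψ k := S (ρ.ψ k)
  p_nonneg := ρ.p_nonneg
  hasSum_p := ρ.hasSum_p
  norm_ψ k := by rw [S.norm_map, ρ.norm_ψ]

end MixedState

/-! ### The weight -/

/-- The Hilbert space `L²(ℝ)` of the weight, in the energy representation `ψ(E) = ⟨E|ψ⟩`. -/
abbrev WeightSpace : Type := Lp ℂ 2 (volume : Measure ℝ)

/-- The maximal domain of the multiplication by `g(E)`. -/
def mulDomain (g : ℝ → ℂ) : Submodule ℂ WeightSpace where
  carrier := {ψ | MemLp (fun E => g E * ψ E) 2 volume}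
  zero_mem' := by
    refine (memLp_congr_ae ?_).2 (MemLp.zero' (α := ℝ) (ε := ℂ))
    filter_upwards [Lp.coeFn_zero ℂ 2 (volume : Measure ℝ)] with E hE
    rw [hE]
    simp
  add_mem' := fun {a b} ha hb => by
    refine (memLp_congr_ae ?_).2 (MemLp.add ha hb)
    filter_upwards [Lp.coeFn_add a b] with E hE
    rw [hE]
    simp [mul_add]
  smul_mem' := fun c a ha => by
    refine (memLp_congr_ae ?_).2 (MemLp.const_smul ha c)
    filter_upwards [Lp.coeFn_smul c a] with E hE
    rw [hE]
    simp [mul_left_comm]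

theorem memLp_of_mem_mulDomain {g : ℝ → ℂ} {ψ : WeightSpace} (h : ψ ∈ mulDomain g) :
    MemLp (fun E => g E * ψ E) 2 volume := h

/-- The function `g(H_W)` of the weight's Hamiltonian: multiplication by `g(E)`, on its maximal
domain. -/
def mulOp (g : ℝ → ℂ) : WeightSpace →ₗ.[ℂ] WeightSpace where
  domain := mulDomain g
  toFun :=
    { toFun := fun ψ => (memLp_of_mem_mulDomain ψ.2).toLp (fun E => g E * (ψ : WeightSpace) E)
      map_add' := fun a b => by
        rw [← MemLp.toLp_add]
        refine MemLp.toLp_congr _ _ ?_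
        filter_upwards [Lp.coeFn_add (a : WeightSpace) b] with E hE
        rw [Submodule.coe_add, hE]
        simp [mul_add]
      map_smul' := fun c a => by
        rw [RingHom.id_apply, ← MemLp.toLp_const_smul]
        refine MemLp.toLp_congr _ _ ?_
        filter_upwards [Lp.coeFn_smul c (a : WeightSpace)] with E hE
        rw [Submodule.coe_smul, hE]
        simp [mul_left_comm] }

/-- The weight's Hamiltonian `H_W = ∫ dE E |E⟩⟨E|`. -/
def weightH : WeightSpace →ₗ.[ℂ] WeightSpace := mulOp fun E => (E : ℂ)

/-- The displacement operator `Γ_ε = exp(-i ε Δ_W)`, `Γ_ε |E⟩ = |E + ε⟩`, that is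
`(Γ_ε ψ)(E) = ψ(E - ε)`; its generator is `Δ_W = -i d/dE`. -/
def displacement (ε : ℝ) : WeightSpace ≃ₗᵢ[ℂ] WeightSpace where
  toFun := Lp.compMeasurePreserving (fun E => E - ε) (measurePreserving_sub_right volume ε)
  invFun := Lp.compMeasurePreserving (fun E => E + ε) (measurePreserving_add_right volume ε)
  map_add' := map_add _
  map_smul' c ψ := (Lp.compMeasurePreservingₗ ℂ (fun E => E - ε)
    (measurePreserving_sub_right volume ε)).map_smul c ψ
  left_inv ψ := by
    have h := (measurePreserving_add_right (volume : Measure ℝ) ε).quasiMeasurePreserving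
    refine Lp.ext ((Lp.coeFn_compMeasurePreserving _ _).trans
      ((h.ae_eq_comp (Lp.coeFn_compMeasurePreserving _ _)).trans ?_))
    exact Filter.Eventually.of_forall fun E => by simp
  right_inv ψ := by
    have h := (measurePreserving_sub_right (volume : Measure ℝ) ε).quasiMeasurePreserving
    refine Lp.ext ((Lp.coeFn_compMeasurePreserving _ _).trans
      ((h.ae_eq_comp (Lp.coeFn_compMeasurePreserving _ _)).trans ?_))
    exact Filter.Eventually.of_forall fun E => by simp
  norm_map' ψ := Lp.norm_compMeasurePreserving ψ _

/-- The kernel `⟨E|ρ_W|E'⟩ = ∑ₖ pₖ ψₖ(E) ψₖ(E')^*`. -/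
def kernel {ι : Type*} (ρW : MixedState ι WeightSpace) (E E' : ℝ) : ℂ :=
  ∑' k, (ρW.p k : ℂ) * (ρW.ψ k E * conj (ρW.ψ k E'))

/-- The Wigner function `W(E,t) = (2π)⁻¹ ∫ dω e^{iωt} ⟨E - ω/2|ρ_W|E + ω/2⟩`. -/
def wigner {ι : Type*} (ρW : MixedState ι WeightSpace) (E t : ℝ) : ℂ :=
  (1 / (2 * Real.pi) : ℂ) *
    ∫ ω : ℝ, Complex.exp (Complex.I * ω * t) * kernel ρW (E - ω / 2) (E + ω / 2)

/-! ### The system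

The system has the Hilbert space `ℂⁿ`, whose standard basis is the energy eigenbasis `|εᵢ⟩`;
operators of the system are matrices in this basis. -/

section System

variable {n κ : Type*} [Fintype n] [DecidableEq n]

/-- The system's Hamiltonian `H_S = ∑ᵢ εᵢ |εᵢ⟩⟨εᵢ|`. -/
def systemH (ε : n → ℝ) : Matrix n n ℂ := Matrix.diagonal fun i => (ε i : ℂ)

/-- The density matrix of a mixed state of the system. -/
def densityMatrix (ρS : MixedState κ (EuclideanSpace ℂ n)) : Matrix n n ℂ :=
  Matrix.of fun i j => ∑' k, (ρS.p k : ℂ) * (ρS.ψ k i * conj (ρS.ψ k j))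

/-- `⟨A⟩_ρ = Tr[A ρ]` for matrices. -/
def matExpect (ρ A : Matrix n n ℂ) : ℂ := (A * ρ).trace

/-- `Cov_ρ[A, B] = ½ ⟨A B + B A⟩_ρ - ⟨A⟩_ρ ⟨B⟩_ρ` for matrices. -/
def matCov (ρ A B : Matrix n n ℂ) : ℂ :=
  (1 / 2 : ℂ) * matExpect ρ (A * B + B * A) - matExpect ρ A * matExpect ρ B

/-- `Var_ρ[A] = Cov_ρ[A, A]` for matrices. -/
def matVar (ρ A : Matrix n n ℂ) : ℂ := matCov ρ A A

/-- The final Hamiltonian `V_S† H_S V_S`. -/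
def finalH (ε : n → ℝ) (V : Matrix n n ℂ) : Matrix n n ℂ :=
  V.conjTranspose * systemH ε * V

/-- The work operator `W_S = H_S - V_S† H_S V_S`. -/
def workOp (ε : n → ℝ) (V : Matrix n n ℂ) : Matrix n n ℂ := systemH ε - finalH ε V

/-- The free evolution `e^{-i H_S t}`. -/
def freeEvol (ε : n → ℝ) (t : ℝ) : Matrix n n ℂ :=
  NormedSpace.exp ((-(Complex.I * t)) • systemH ε)

/-- The Heisenberg-picture work operator `W_S(t) = e^{i H_S t} W_S e^{-i H_S t}`. -/
def workOpAt (ε : n → ℝ) (V : Matrix n n ℂ) (t : ℝ) : Matrix n n ℂ :=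
  freeEvol ε (-t) * workOp ε V * freeEvol ε t

/-- The operator
`ξ_S(s) = (∫ dt ∫ dE e^{iEs} W(E,t) e^{-i H_S t} ρ_S e^{i H_S t}) / Tr[e^{i H_W s} ρ_W]`
(matrix-valued integrals are taken entrywise). -/
def xi {ι : Type*} (ε : n → ℝ) (ρS : MixedState κ (EuclideanSpace ℂ n))
    (ρW : MixedState ι WeightSpace) (s : ℝ) : Matrix n n ℂ :=
  Matrix.of fun i j =>
    (∫ t : ℝ, ∫ E : ℝ, Complex.exp (Complex.I * E * s) * wigner ρW E t *
        (freeEvol ε t * densityMatrix ρS * freeEvol ε (-t)) i j) /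
      ρW.expect (mulOp fun E => Complex.exp (Complex.I * E * s))

/-- The entrywise derivative `ξ_S'(0)`. -/
def xiDerivZero {ι : Type*} (ε : n → ℝ) (ρS : MixedState κ (EuclideanSpace ℂ n))
    (ρW : MixedState ι WeightSpace) : Matrix n n ℂ :=
  Matrix.of fun i j => deriv (fun s => xi ε ρS ρW s i j) 0

end System

/-! ### The composite system -/

/-- The composite Hilbert space `ℂⁿ ⊗ L²(ℝ)`, as the Hilbert sum of copies of `L²(ℝ)`: the vector
`∑ᵢ |εᵢ⟩ ⊗ Ψᵢ` is the family `(Ψᵢ)ᵢ`. -/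
abbrev TotalSpace (n : Type*) : Type _ := PiLp 2 fun _ : n => WeightSpace

section Composite

variable {n κ ι : Type*} [Fintype n]

/-- The product vector `v ⊗ ψ`. -/
def tensor (v : EuclideanSpace ℂ n) (ψ : WeightSpace) : TotalSpace n :=
  WithLp.toLp 2 fun i => v i • ψ

theorem norm_tensor (v : EuclideanSpace ℂ n) (ψ : WeightSpace) :
    ‖tensor v ψ‖ = ‖v‖ * ‖ψ‖ := by
  rw [PiLp.norm_eq_of_L2, EuclideanSpace.norm_eq, ← Real.sqrt_sq (norm_nonneg ψ),
    ← Real.sqrt_mul (Finset.sum_nonneg fun _ _ => by positivity), Finset.sum_mul]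
  simp [tensor, norm_smul, mul_pow]

/-- The product state `ρ_S ⊗ ρ_W`. -/
def prodState (ρS : MixedState κ (EuclideanSpace ℂ n)) (ρW : MixedState ι WeightSpace) :
    MixedState (κ × ι) (TotalSpace n) where
  p k := ρS.p k.1 * ρW.p k.2
  ψ k := tensor (ρS.ψ k.1) (ρW.ψ k.2)
  p_nonneg k := mul_nonneg (ρS.p_nonneg _) (ρW.p_nonneg _)
  hasSum_p := by
    have hs := ρS.hasSum_p.summable.mul_of_nonneg ρW.hasSum_p.summable ρS.p_nonneg ρW.p_nonneg
    have h := HasSum.mul ρS.hasSum_p ρW.hasSum_p hs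
    rwa [one_mul] at h
  norm_ψ k := by rw [norm_tensor, ρS.norm_ψ, ρW.norm_ψ, one_mul]

/-- The operator `M ⊗ 1` for a matrix `M` of the system: `(M Ψ)ᵢ = ∑ⱼ Mᵢⱼ Ψⱼ`. -/
def onSystem (M : Matrix n n ℂ) : TotalSpace n →L[ℂ] TotalSpace n :=
  (PiLp.continuousLinearEquiv 2 ℂ fun _ : n => WeightSpace).symm.toContinuousLinearMap ∘L
    ContinuousLinearMap.pi fun i => ∑ j, M i j • PiLp.proj 2 (fun _ : n => WeightSpace) j

/-- The operator `1 ⊗ A` for an operator `A` of the weight, `(A Ψ)ᵢ = A Ψᵢ`. -/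
def onWeight (A : WeightSpace →ₗ.[ℂ] WeightSpace) : TotalSpace n →ₗ.[ℂ] TotalSpace n where
  domain :=
    { carrier := {Ψ | ∀ i, Ψ i ∈ A.domain}
      zero_mem' := fun _ => A.domain.zero_mem
      add_mem' := fun ha hb i => A.domain.add_mem (ha i) (hb i)
      smul_mem' := fun c _ ha i => A.domain.smul_mem c (ha i) }
  toFun :=
    { toFun := fun Ψ => WithLp.toLp 2 fun i => A ⟨(Ψ : TotalSpace n) i, Ψ.2 i⟩
      map_add' := fun a b => by
        ext1 i
        exact A.map_add ⟨(a : TotalSpace n) i, a.2 i⟩ ⟨(b : TotalSpace n) i, b.2 i⟩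
      map_smul' := fun c a => by
        ext1 i
        exact A.map_smul c ⟨(a : TotalSpace n) i, a.2 i⟩ }

variable [DecidableEq n]

/-- `S = exp(-i H_S ⊗ Δ_W) = ∑ᵢ |εᵢ⟩⟨εᵢ| ⊗ Γ_{εᵢ}`, that is `S |εᵢ, E⟩ = |εᵢ, E + εᵢ⟩`. -/
def controlS (ε : n → ℝ) : TotalSpace n ≃ₗᵢ[ℂ] TotalSpace n :=
  LinearIsometryEquiv.piLpCongrRight 2 fun i => displacement (ε i)

/-- The energy-conserving and translation-invariant unitary `U = S† V_S S`. -/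
def totalU (ε : n → ℝ) (V : Matrix n n ℂ) : TotalSpace n →L[ℂ] TotalSpace n :=
  ((controlS ε).symm : TotalSpace n →L[ℂ] TotalSpace n) ∘L onSystem V ∘L
    (controlS ε : TotalSpace n →L[ℂ] TotalSpace n)

/-- The partial trace `Tr_W` of a state: `⟨εᵢ| Tr_W |Ψ⟩⟨Ψ| |εⱼ⟩ = ⟨Ψⱼ, Ψᵢ⟩`. -/
def reducedS (ρ : MixedState ι (TotalSpace n)) : Matrix n n ℂ :=
  Matrix.of fun i j => ∑' k, (ρ.p k : ℂ) * inner ℂ (ρ.ψ k j) (ρ.ψ k i)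

/-- The control state `σ = S (ρ_S ⊗ ρ_W) S†`. -/
def controlState (ε : n → ℝ) (ρS : MixedState κ (EuclideanSpace ℂ n))
    (ρW : MixedState ι WeightSpace) : MixedState (κ × ι) (TotalSpace n) :=
  (prodState ρS ρW).map (controlS ε)

/-- The control-marginal state `σ_S = Tr_W[σ]`. -/
def controlMarginal (ε : n → ℝ) (ρS : MixedState κ (EuclideanSpace ℂ n))
    (ρW : MixedState ι WeightSpace) : Matrix n n ℂ :=
  reducedS (controlState ε ρS ρW)

/-- `ΔE_W = ⟨U† H_W U⟩_ρ - ⟨H_W⟩_ρ` with `ρ = ρ_S ⊗ ρ_W`. -/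
def deltaE (ε : n → ℝ) (V : Matrix n n ℂ) (ρS : MixedState κ (EuclideanSpace ℂ n))
    (ρW : MixedState ι WeightSpace) : ℂ :=
  (prodState ρS ρW).expect (heisenberg (totalU ε V) (onWeight weightH))
    - (prodState ρS ρW).expect (onWeight weightH)

/-- `Δσ_W² = Var_ρ[U† H_W U] - Var_ρ[H_W]` with `ρ = ρ_S ⊗ ρ_W`. -/
def deltaVar (ε : n → ℝ) (V : Matrix n n ℂ) (ρS : MixedState κ (EuclideanSpace ℂ n))
    (ρW : MixedState ι WeightSpace) : ℂ :=
  (prodState ρS ρW).var (heisenberg (totalU ε V) (onWeight weightH))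
    - (prodState ρS ρW).var (onWeight weightH)

/-- `F = Cov_σ[H_S - H_W, V_S† H_S V_S]`. -/
def fTerm (ε : n → ℝ) (V : Matrix n n ℂ) (ρS : MixedState κ (EuclideanSpace ℂ n))
    (ρW : MixedState ι WeightSpace) : ℂ :=
  (controlState ε ρS ρW).cov (ofBounded (onSystem (systemH ε)) - onWeight weightH)
    (ofBounded (onSystem (finalH ε V)))

end Composite

end QWeight

end

/-!
Since `U` conserves the total energy, `U† H_W U = H_W + S† W_S S`; conjugating by `S`, both energy
statistics become statements about `H_W - H_S` and `W_S` in the control state `σ`. The change of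
the mean is then immediate, and bilinearity of the covariance yields the change of the variance:
the cross term `Cov_σ[H_W - H_S, H_S]` is the covariance of `H_W` and `H_S` in the product state
`ρ_S ⊗ ρ_W` and vanishes. Written in the energy basis, `F` is a sum of matrix elements of `W_S` and
`ρ_S` weighted by the covariances of `H_W` and `Γ_δ` in `ρ_W`, where `δ` is a Bohr frequency.

For the Wigner function, `s ↦ ∫ dE e^{iEs} W(E, ·)` is regarded as a curve in `L¹`: for a pure
state it is the product of the Fourier transforms of `e^{iEs/2} ψ` and of `e^{-iEs/2} ψ`
(conjugated), hence differentiable as soon as `E ψ` is square integrable. Its Fourier coefficients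
at `s = 0` are the means of `Γ_δ`, and those of its derivative are the correlations of `H_W` and
`Γ_δ`, which gives `F = -i Tr[W_S ξ_S'(0)]`. If moreover `E W(E, t)` is integrable in `E` for almost
every `t`, then the `L¹` derivative agrees almost everywhere with the pointwise one, because a
subsequence of the difference quotients converges almost everywhere; its Fourier coefficients then
give the Wigner form of `F`.
-/

noncomputable section

namespace QWeight

open FourierTransform Filter Topology
open scoped ENNReal

/-! ### Lebesgue spaces -/

section Lebesgue

variable {α ι F : Type*} [MeasurableSpace α] {μ : Measure α} [NormedAddCommGroup F]

theorem integrable_tsum_of_summable_integral_norm [NormedSpace ℝ F] [CompleteSpace F]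
    [Countable ι] {f : ι → α → F} (hf : ∀ i, Integrable (f i) μ)
    (hs : Summable fun i => ∫ a, ‖f i a‖ ∂μ) : Integrable (fun a => ∑' i, f i a) μ := by
  have htop : ∑' i, ‖(hf i).toL1 (f i)‖ₑ ≠ ⊤ := by
    simp only [← ofReal_norm, L1.norm_of_fun_eq_integral_norm]
    exact hs.tsum_ofReal_ne_top
  refine (L1.integrable_coeFn (∑' i, (hf i).toL1 (f i))).congr ?_
  filter_upwards [Lp.coeFn_tsum htop, ae_all_iff.2 fun i => (hf i).coeFn_toL1] with a hsum hterm
  rw [hsum]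
  exact tsum_congr hterm

theorem tendsto_eLpNorm_zero_of_dominated {p : ℝ≥0∞} (hp : p ≠ ⊤) {l : Filter ι}
    [l.IsCountablyGenerated] {f : ι → α → F} {bound : α → ℝ}
    (hf : ∀ i, AEStronglyMeasurable (f i) μ) (hbound : MemLp bound p μ)
    (hle : ∀ᶠ i in l, ∀ᵐ a ∂μ, ‖f i a‖ ≤ bound a)
    (hlim : ∀ᵐ a ∂μ, Tendsto (fun i => f i a) l (𝓝 0)) :
    Tendsto (fun i => eLpNorm (f i) p μ) l (𝓝 0) := by
  rcases eq_or_ne p 0 with rfl | hp0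
  · simpa using tendsto_const_nhds
  have hpos : 0 < p.toReal := ENNReal.toReal_pos hp0 hp
  simp only [eLpNorm_eq_lintegral_rpow_enorm_toReal hp0 hp]
  have hf_int : Tendsto (fun i => ∫⁻ a, ‖f i a‖ₑ ^ p.toReal ∂μ) l (𝓝 (∫⁻ _, 0 ∂μ)) := by
    refine tendsto_lintegral_filter_of_dominated_convergence' (fun a => ‖bound a‖ₑ ^ p.toReal)
      (Eventually.of_forall fun i => (hf i).enorm.pow_const _) (hle.mono fun i hi => ?_)
      (lintegral_rpow_enorm_lt_top_of_eLpNorm_lt_top hp0 hp hbound.2).ne ?_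
    · filter_upwards [hi] with a ha
      exact ENNReal.rpow_le_rpow (enorm_le_iff_norm_le.2 (ha.trans (le_abs_self _))) hpos.le
    · filter_upwards [hlim] with a ha
      simpa [hpos] using ha.enorm.ennrpow_const p.toReal
  simpa [hpos] using hf_int.ennrpow_const (1 / p.toReal)

theorem hasDerivAt_Lp_of_dominated [NormedSpace ℝ F] {p : ℝ≥0∞} [Fact (1 ≤ p)] (hp : p ≠ ⊤)
    {Φ : ℝ → Lp F p μ} {Φ' : Lp F p μ} {f : ℝ → α → F} {f' : α → F} {x : ℝ} {bound : α → ℝ}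
    (hΦ : ∀ s, Φ s =ᵐ[μ] f s) (hΦ' : Φ' =ᵐ[μ] f') (hbound : MemLp bound p μ)
    (hlip : ∀ᵐ a ∂μ, ∀ s, ‖f s a - f x a‖ ≤ bound a * |s - x|)
    (hderiv : ∀ᵐ a ∂μ, HasDerivAt (fun s => f s a) (f' a) x) : HasDerivAt Φ Φ' x := by
  have hslope : ∀ s, ⇑(slope Φ x s) - ⇑Φ' =ᵐ[μ] fun a => slope (fun s => f s a) x s - f' a := by
    intro s
    simp only [slope_def_module]
    filter_upwards [hΦ s, hΦ x, hΦ', Lp.coeFn_smul (s - x)⁻¹ (Φ s - Φ x),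
      Lp.coeFn_sub (Φ s) (Φ x)] with a hs hx h' hsmul hsub
    rw [Pi.sub_apply, hsmul, Pi.smul_apply, hsub, Pi.sub_apply, hs, hx, h']
  rw [hasDerivAt_iff_tendsto_slope, Lp.tendsto_Lp_iff_tendsto_eLpNorm']
  simp only [fun s => eLpNorm_congr_ae (p := p) (hslope s)]
  refine tendsto_eLpNorm_zero_of_dominated hp
    (fun s => ((Lp.aestronglyMeasurable _).sub (Lp.aestronglyMeasurable _)).congr (hslope s))
    (hbound.add (Lp.memLp Φ').norm) (eventually_mem_nhdsWithin.mono fun s hs => ?_) ?_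
  · filter_upwards [hlip, hΦ'] with a hle h'
    rw [Pi.add_apply, h']
    refine (norm_sub_le _ _).trans (add_le_add_left ?_ _)
    have hpos : 0 < |s - x| := abs_pos.2 (sub_ne_zero.2 hs)
    rw [slope_def_module, norm_smul, norm_inv, Real.norm_eq_abs, inv_mul_le_iff₀ hpos, mul_comm]
    exact hle s
  · filter_upwards [hderiv] with a ha
    simpa using (hasDerivAt_iff_tendsto_slope.1 ha).sub_const (f' a)

theorem ae_eq_of_hasDerivAt_Lp [NormedSpace ℝ F] {p : ℝ≥0∞} [Fact (1 ≤ p)]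
    {Φ : ℝ → Lp F p μ} {Φ' : Lp F p μ} {f : ℝ → α → F} {f' : α → F} {x : ℝ}
    (hΦ : ∀ s, Φ s =ᵐ[μ] f s) (hderiv : HasDerivAt Φ Φ' x)
    (hf : ∀ᵐ a ∂μ, HasDerivAt (fun s => f s a) (f' a) x) : Φ' =ᵐ[μ] f' := by
  obtain ⟨u, hu, hu_ae⟩ := (tendstoInMeasure_of_tendsto_Lp
    (hasDerivAt_iff_tendsto_slope.1 hderiv)).exists_seq_tendsto_ae'
  have hslope : ∀ᵐ a ∂μ, ∀ m, slope Φ x (u m) a = slope (fun s => f s a) x (u m) := by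
    refine ae_all_iff.2 fun m => ?_
    filter_upwards [hΦ (u m), hΦ x, Lp.coeFn_smul (u m - x)⁻¹ (Φ (u m) - Φ x),
      Lp.coeFn_sub (Φ (u m)) (Φ x)] with a hum hx hsmul hsub
    rw [slope_def_module, slope_def_module, hsmul, Pi.smul_apply, hsub, Pi.sub_apply, hum, hx]
  filter_upwards [hslope, hu_ae, hf] with a hslope_a hlim hderiv_a
  simp only [hslope_a] at hlim
  exact tendsto_nhds_unique hlim ((hasDerivAt_iff_tendsto_slope.1 hderiv_a).comp hu)

theorem norm_sq_eq_integral_norm_sq (f : Lp F 2 μ) : ‖f‖ ^ 2 = ∫ a, ‖f a‖ ^ 2 ∂μ := by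
  have h := (Lp.memLp f).eLpNorm_eq_integral_rpow_norm two_ne_zero ENNReal.ofNat_ne_top
  rw [Lp.norm_def, h, ENNReal.toReal_ofReal (by positivity), ← Real.rpow_natCast,
    ← Real.rpow_mul (integral_nonneg fun _ => by positivity)]
  simp

theorem sq_integral_mul_le {f g : α → ℝ} (hf : MemLp f 2 μ) (hg : MemLp g 2 μ) :
    (∫ a, f a * g a ∂μ) ^ 2 ≤ (∫ a, f a ^ 2 ∂μ) * ∫ a, g a ^ 2 ∂μ := by
  have hinner {u v : α → ℝ} (hu : MemLp u 2 μ) (hv : MemLp v 2 μ) :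
      inner ℝ (hu.toLp u) (hv.toLp v) = ∫ a, u a * v a ∂μ := by
    rw [L2.inner_def]
    refine integral_congr_ae ?_
    filter_upwards [hu.coeFn_toLp, hv.coeFn_toLp] with a hua hva
    rw [hua, hva, Real.inner_apply]
  simp only [sq, ← hinner, hf, hg]
  exact real_inner_mul_inner_self_le _ _

theorem integrable_and_sq_integral_norm_le [NormedSpace ℝ F] {f : ℝ → F} (hf : MemLp f 2)
    (hf' : MemLp (fun x => x • f x) 2) : Integrable f ∧
    (∫ x, ‖f x‖) ^ 2 ≤ Real.pi * ((∫ x, ‖f x‖ ^ 2) + ∫ x, ‖x • f x‖ ^ 2) := by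
  let w : ℝ → ℝ := fun x => √(1 + x ^ 2)
  have hw : ∀ x, 0 < w x := fun x => Real.sqrt_pos.2 (by positivity)
  have hw_sq : ∀ x, w x ^ 2 = 1 + x ^ 2 := fun x => Real.sq_sqrt (by positivity)
  have hcont : Continuous w := by fun_prop
  have hwf_sq : ∀ x, (w x * ‖f x‖) ^ 2 = ‖f x‖ ^ 2 + ‖x • f x‖ ^ 2 := fun x => by
    rw [mul_pow, hw_sq, norm_smul, mul_pow, Real.norm_eq_abs, sq_abs, add_mul, one_mul]
  have hinv : MemLp (fun x => (w x)⁻¹) 2 := by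
    refine (memLp_two_iff_integrable_sq
      (hcont.inv₀ fun x => (hw x).ne').aestronglyMeasurable).2 ?_
    simpa only [Pi.inv_apply, inv_pow, hw_sq] using integrable_inv_one_add_sq
  have hwf : MemLp (fun x => w x * ‖f x‖) 2 := by
    refine (memLp_two_iff_integrable_sq (hcont.aestronglyMeasurable.mul hf.1.norm)).2 ?_
    exact (hf.norm.integrable_sq.add hf'.norm.integrable_sq).congr
      (.of_forall fun x => (hwf_sq x).symm)
  have hprod : ∀ x, (w x)⁻¹ * (w x * ‖f x‖) = ‖f x‖ := fun x =>
    inv_mul_cancel_left₀ (hw x).ne' _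
  have hf_int : Integrable f := by
    rw [← integrable_norm_iff hf.1]
    simpa only [Pi.mul_def, hprod] using hinv.integrable_mul hwf
  refine ⟨hf_int, ?_⟩
  have hCS := sq_integral_mul_le hinv hwf
  simp only [hprod, hwf_sq, inv_pow, hw_sq, integral_univ_inv_one_add_sq] at hCS
  rwa [integral_add hf.norm.integrable_sq hf'.norm.integrable_sq] at hCS

end Lebesgue

/-! ### The Fourier transform on `L²` -/

section Fourier

variable {V F : Type*} [NormedAddCommGroup V] [InnerProductSpace ℝ V] [FiniteDimensional ℝ V]
  [MeasurableSpace V] [BorelSpace V] [NormedAddCommGroup F] [InnerProductSpace ℂ F]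
  [CompleteSpace F]

theorem coeFn_fourier_ae_eq_of_integrable (f : Lp F 2 (volume : Measure V)) (hf : Integrable f) :
    ⇑(𝓕 f : Lp F 2 (volume : Measure V)) =ᵐ[volume] 𝓕 (f : V → F) := by
  have hcont : Continuous (𝓕 (f : V → F)) :=
    VectorFourier.fourierIntegral_continuous Real.continuous_fourierChar continuous_inner hf
  refine ae_eq_of_integral_contDiff_smul_eq ((Lp.memLp _).locallyIntegrable (by norm_num))
    hcont.locallyIntegrable fun g hg hgc => ?_
  have hg₁ : HasCompactSupport (Complex.ofRealCLM ∘ g) := hgc.comp_left rfl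
  have hg₂ : ContDiff ℝ (⊤ : ℕ∞) (Complex.ofRealCLM ∘ g) := by fun_prop
  let G := hg₁.toSchwartzMap hg₂
  have hG : ∀ x (v : F), G x • v = g x • v := fun x v => Complex.coe_smul (g x) v
  have hdistr := congrArg (fun T => T G) (Lp.fourier_toTemperedDistribution_eq f)
  have hflip := VectorFourier.integral_fourierIntegral_smul_eq_flip (L := innerₗ V)
    Real.continuous_fourierChar continuous_inner (G.integrable (μ := volume)) hf
  simp only [TemperedDistribution.fourier_apply, Lp.toTemperedDistribution_apply,
    SchwartzMap.fourier_coe, hG] at hdistr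
  simp only [flip_innerₗ, hG] at hflip
  exact hdistr.symm.trans hflip

end Fourier

/-! ### Unbounded operators -/

section UnboundedOperators

variable {H : Type*} [NormedAddCommGroup H] [InnerProductSpace ℂ H] {A B : H →ₗ.[ℂ] H}

theorem app_of_mem {x : H} (hx : x ∈ A.domain) : app A x = A ⟨x, hx⟩ := dif_pos hx

theorem app_of_notMem {x : H} (hx : x ∉ A.domain) : app A x = 0 := dif_neg hx

theorem app_smul (A : H →ₗ.[ℂ] H) (c : ℂ) (x : H) : app A (c • x) = c • app A x := by
  rcases eq_or_ne c 0 with rfl | hc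
  · rw [zero_smul, zero_smul, app_of_mem A.domain.zero_mem]
    exact A.map_zero
  have hiff : c • x ∈ A.domain ↔ x ∈ A.domain := A.domain.smul_mem_iff hc
  by_cases hx : x ∈ A.domain
  · rw [app_of_mem hx, app_of_mem (hiff.2 hx)]
    exact A.map_smul c ⟨x, hx⟩
  · rw [app_of_notMem hx, app_of_notMem (hiff.not.2 hx), smul_zero]

theorem app_add {x : H} (hA : x ∈ A.domain) (hB : x ∈ B.domain) :
    app (A + B) x = app A x + app B x := by
  rw [app_of_mem (A := A + B) ⟨hA, hB⟩, app_of_mem hA, app_of_mem hB]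
  rfl

theorem app_neg (A : H →ₗ.[ℂ] H) (x : H) : app (-A) x = -app A x := by
  by_cases hx : x ∈ A.domain
  · rw [app_of_mem hx, app_of_mem (A := -A) hx]
    rfl
  · rw [app_of_notMem hx, app_of_notMem (A := -A) hx, neg_zero]

theorem app_sum {γ : Type*} (s : Finset γ) {x : γ → H} (hx : ∀ j ∈ s, x j ∈ A.domain) :
    app A (∑ j ∈ s, x j) = ∑ j ∈ s, app A (x j) := by
  classical
  induction s using Finset.induction_on with
  | empty => exact (app_of_mem A.domain.zero_mem).trans A.map_zero
  | insert j s hj ih =>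
    have hxj := hx j (Finset.mem_insert_self j s)
    have hxs := fun i hi => hx i (Finset.mem_insert_of_mem hi)
    have hsum := Submodule.sum_mem _ hxs
    rw [Finset.sum_insert hj, Finset.sum_insert hj, ← ih hxs, app_of_mem hxj, app_of_mem hsum,
      app_of_mem (A.domain.add_mem hxj hsum)]
    exact A.map_add ⟨x j, hxj⟩ ⟨_, hsum⟩

theorem ext_app (hdom : A.domain = B.domain) (happ : ∀ x ∈ A.domain, app A x = app B x) :
    A = B :=
  LinearPMap.ext hdom fun x hA hB => by
    rw [← app_of_mem hA, ← app_of_mem hB, happ x hA]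

theorem app_ofBounded (T : H →L[ℂ] H) (x : H) : app (ofBounded T) x = T x :=
  app_of_mem (A := ofBounded T) Submodule.mem_top

theorem ofBounded_add (T T' : H →L[ℂ] H) : ofBounded (T + T') = ofBounded T + ofBounded T' :=
  ext_app (inf_idem ⊤).symm fun x _ => by
    rw [app_add (A := ofBounded T) (B := ofBounded T') Submodule.mem_top Submodule.mem_top]
    simp only [app_ofBounded, add_apply]

theorem ofBounded_neg (T : H →L[ℂ] H) : ofBounded (-T) = -ofBounded T :=
  ext_app rfl fun x _ => by simp only [app_neg, app_ofBounded, neg_apply]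

theorem ofBounded_sub (T T' : H →L[ℂ] H) : ofBounded (T - T') = ofBounded T - ofBounded T' := by
  rw [sub_eq_add_neg, ofBounded_add, ofBounded_neg, sub_eq_add_neg]

theorem ofBounded_zero : ofBounded (0 : H →L[ℂ] H) = 0 :=
  ext_app rfl fun x hx => by
    rw [app_ofBounded, app_of_mem (A := 0) hx]
    rfl

variable [CompleteSpace H]

theorem app_heisenberg (U : H →L[ℂ] H) (A : H →ₗ.[ℂ] H) (x : H) :
    app (heisenberg U A) x = ContinuousLinearMap.adjoint U (app A (U x)) := by
  by_cases hx : U x ∈ A.domain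
  · rw [app_of_mem hx, app_of_mem (A := heisenberg U A) hx]
    rfl
  · rw [app_of_notMem hx, app_of_notMem (A := heisenberg U A) hx, map_zero]

theorem app_heisenberg_isometry (S : H ≃ₗᵢ[ℂ] H) (A : H →ₗ.[ℂ] H) (x : H) :
    app (heisenberg (S : H →L[ℂ] H) A) x = S.symm (app A (S x)) := by
  rw [app_heisenberg, S.adjoint_eq_symm]
  rfl

theorem heisenberg_comp (U U' : H →L[ℂ] H) (A : H →ₗ.[ℂ] H) :
    heisenberg (U ∘L U') A = heisenberg U' (heisenberg U A) :=
  ext_app rfl fun x _ => by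
    simp only [app_heisenberg, ContinuousLinearMap.adjoint_comp, ContinuousLinearMap.comp_apply]

theorem heisenberg_add (U : H →L[ℂ] H) (A B : H →ₗ.[ℂ] H) :
    heisenberg U (A + B) = heisenberg U A + heisenberg U B :=
  ext_app rfl fun x hx => by
    rw [app_heisenberg, app_add (x := U x) hx.1 hx.2, map_add,
      app_add (A := heisenberg U A) (B := heisenberg U B) hx.1 hx.2, app_heisenberg,
      app_heisenberg]

theorem heisenberg_neg (U : H →L[ℂ] H) (A : H →ₗ.[ℂ] H) :
    heisenberg U (-A) = -heisenberg U A :=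
  ext_app rfl fun x _ => by simp only [app_heisenberg, app_neg, map_neg]

theorem heisenberg_sub (U : H →L[ℂ] H) (A B : H →ₗ.[ℂ] H) :
    heisenberg U (A - B) = heisenberg U A - heisenberg U B := by
  rw [sub_eq_add_neg, heisenberg_add, heisenberg_neg, sub_eq_add_neg]

theorem heisenberg_ofBounded (U T : H →L[ℂ] H) :
    heisenberg U (ofBounded T) = ofBounded (ContinuousLinearMap.adjoint U ∘L T ∘L U) :=
  ext_app rfl fun x _ => by
    simp only [app_heisenberg, app_ofBounded, ContinuousLinearMap.comp_apply]

end UnboundedOperators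

/-! ### Moments of observables in a mixed state -/

theorem summable_inner_of_summable_norm_sq {ι H : Type*} [NormedAddCommGroup H]
    [InnerProductSpace ℂ H] {f g : ι → H} (hf : Summable fun k => ‖f k‖ ^ 2)
    (hg : Summable fun k => ‖g k‖ ^ 2) : Summable fun k => inner ℂ (f k) (g k) := by
  refine .of_norm_bounded (hf.add hg) fun k => ?_
  have := norm_inner_le_norm (𝕜 := ℂ) (f k) (g k)
  nlinarith [sq_nonneg (‖f k‖ - ‖g k‖), sq_nonneg ‖f k‖, sq_nonneg ‖g k‖]

namespace MixedState

section Moments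

variable {ι H : Type*} [NormedAddCommGroup H] [InnerProductSpace ℂ H]

/-- The subnormalised vectors `φₖ = √pₖ ψₖ`, so that `ρ = ∑ₖ |φₖ⟩⟨φₖ|`. Unlike `ψₖ`, the vector
`φₖ` lies in the domain of every observable when `pₖ = 0`. -/
def amplitude (ρ : MixedState ι H) (k : ι) : H := (√(ρ.p k) : ℂ) • ρ.ψ k

variable {ρ : MixedState ι H} {A B C : H →ₗ.[ℂ] H}

theorem sqrt_p_mul_self (ρ : MixedState ι H) (k : ι) : (√(ρ.p k) : ℂ) * √(ρ.p k) = ρ.p k := by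
  rw [← Complex.ofReal_mul, Real.mul_self_sqrt (ρ.p_nonneg k)]

theorem inner_sqrt_smul (ρ : MixedState ι H) {H' : Type*} [NormedAddCommGroup H']
    [InnerProductSpace ℂ H'] (k : ι) (x y : H') :
    inner ℂ ((√(ρ.p k) : ℂ) • x) ((√(ρ.p k) : ℂ) • y) = ρ.p k * inner ℂ x y := by
  rw [inner_smul_left, inner_smul_right, Complex.conj_ofReal, ← mul_assoc, sqrt_p_mul_self]

theorem app_amplitude (ρ : MixedState ι H) (A : H →ₗ.[ℂ] H) (k : ι) :
    app A (ρ.amplitude k) = (√(ρ.p k) : ℂ) • app A (ρ.ψ k) :=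
  app_smul A _ _

theorem norm_sq_app_amplitude (ρ : MixedState ι H) (A : H →ₗ.[ℂ] H) (k : ι) :
    ‖app A (ρ.amplitude k)‖ ^ 2 = ρ.p k * ‖app A (ρ.ψ k)‖ ^ 2 := by
  rw [app_amplitude, norm_smul, mul_pow, Complex.norm_real, Real.norm_eq_abs, sq_abs,
    Real.sq_sqrt (ρ.p_nonneg k)]

theorem norm_sq_amplitude (ρ : MixedState ι H) (k : ι) : ‖ρ.amplitude k‖ ^ 2 = ρ.p k := by
  rw [amplitude, norm_smul, ρ.norm_ψ, mul_one, Complex.norm_real, Real.norm_eq_abs, sq_abs,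
    Real.sq_sqrt (ρ.p_nonneg k)]

theorem hasSum_norm_sq_amplitude (ρ : MixedState ι H) :
    HasSum (fun k => ‖ρ.amplitude k‖ ^ 2) 1 := by
  simpa only [norm_sq_amplitude] using ρ.hasSum_p

theorem amplitude_mem_iff (k : ι) :
    ρ.amplitude k ∈ A.domain ↔ (ρ.p k ≠ 0 → ρ.ψ k ∈ A.domain) := by
  by_cases hp : ρ.p k = 0
  · simp [amplitude, hp]
  · have hsqrt : (√(ρ.p k) : ℂ) ≠ 0 := by
      simpa [Real.sqrt_eq_zero (ρ.p_nonneg k)] using hp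
    rw [amplitude, A.domain.smul_mem_iff hsqrt, forall_prop_of_true hp]

theorem finiteSecondMoment_iff : ρ.FiniteSecondMoment A ↔
    (∀ k, ρ.amplitude k ∈ A.domain) ∧ Summable fun k => ‖app A (ρ.amplitude k)‖ ^ 2 := by
  simp only [FiniteSecondMoment, amplitude_mem_iff, norm_sq_app_amplitude]

theorem FiniteSecondMoment.mem (hA : ρ.FiniteSecondMoment A) (k : ι) :
    ρ.amplitude k ∈ A.domain := (finiteSecondMoment_iff.1 hA).1 k

theorem FiniteSecondMoment.summable (hA : ρ.FiniteSecondMoment A) :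
    Summable fun k => ‖app A (ρ.amplitude k)‖ ^ 2 := (finiteSecondMoment_iff.1 hA).2

theorem FiniteSecondMoment.add (hA : ρ.FiniteSecondMoment A) (hB : ρ.FiniteSecondMoment B) :
    ρ.FiniteSecondMoment (A + B) := by
  refine finiteSecondMoment_iff.2 ⟨fun k => ⟨hA.mem k, hB.mem k⟩, ?_⟩
  refine .of_nonneg_of_le (fun k => sq_nonneg _) (fun k => ?_)
    ((hA.summable.add hB.summable).mul_left 2)
  rw [app_add (hA.mem k) (hB.mem k)]
  exact (pow_le_pow_left₀ (norm_nonneg _) (norm_add_le _ _) 2).trans add_sq_le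

theorem FiniteSecondMoment.neg (hA : ρ.FiniteSecondMoment A) : ρ.FiniteSecondMoment (-A) :=
  finiteSecondMoment_iff.2 ⟨hA.mem, by simpa only [app_neg, norm_neg] using hA.summable⟩

theorem finiteSecondMoment_ofBounded (ρ : MixedState ι H) (T : H →L[ℂ] H) :
    ρ.FiniteSecondMoment (ofBounded T) := by
  refine finiteSecondMoment_iff.2 ⟨fun k => Submodule.mem_top, ?_⟩
  refine .of_nonneg_of_le (fun k => sq_nonneg _) (fun k => ?_)
    (ρ.hasSum_norm_sq_amplitude.summable.mul_left (‖T‖ ^ 2))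
  rw [app_ofBounded, ← mul_pow]
  exact pow_le_pow_left₀ (norm_nonneg _) (T.le_opNorm _) 2

theorem expect_eq_tsum (ρ : MixedState ι H) (A : H →ₗ.[ℂ] H) :
    ρ.expect A = ∑' k, inner ℂ (ρ.amplitude k) (app A (ρ.amplitude k)) := by
  simp only [expect, app_amplitude]
  exact tsum_congr fun k => (inner_sqrt_smul ρ k _ _).symm

/-- The moment `⟨A† B⟩_ρ`, as the quadratic form `∑ₖ ⟨A φₖ, B φₖ⟩`. -/
def moment (ρ : MixedState ι H) (A B : H →ₗ.[ℂ] H) : ℂ :=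
  ∑' k, inner ℂ (app A (ρ.amplitude k)) (app B (ρ.amplitude k))

theorem FiniteSecondMoment.summable_inner (hA : ρ.FiniteSecondMoment A)
    (hB : ρ.FiniteSecondMoment B) :
    Summable fun k => inner ℂ (app A (ρ.amplitude k)) (app B (ρ.amplitude k)) :=
  summable_inner_of_summable_norm_sq hA.summable hB.summable

theorem FiniteSecondMoment.summable_inner_amplitude (hA : ρ.FiniteSecondMoment A) :
    Summable fun k => inner ℂ (ρ.amplitude k) (app A (ρ.amplitude k)) :=
  summable_inner_of_summable_norm_sq ρ.hasSum_norm_sq_amplitude.summable hA.summable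

theorem cov_eq_moment (hA : ρ.FiniteSecondMoment A) (hB : ρ.FiniteSecondMoment B) :
    ρ.cov A B = 1 / 2 * (ρ.moment A B + ρ.moment B A) - ρ.expect A * ρ.expect B := by
  rw [cov, moment, moment, ← (hA.summable_inner hB).tsum_add (hB.summable_inner hA),
    ← tsum_mul_left]
  simp only [app_amplitude, inner_sqrt_smul]
  congr 1
  exact tsum_congr fun k => by ring

theorem cov_comm (ρ : MixedState ι H) (A B : H →ₗ.[ℂ] H) : ρ.cov A B = ρ.cov B A := by
  simp only [cov, add_comm, mul_comm]

theorem expect_add (hA : ρ.FiniteSecondMoment A) (hB : ρ.FiniteSecondMoment B) :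
    ρ.expect (A + B) = ρ.expect A + ρ.expect B := by
  simp only [expect_eq_tsum]
  rw [← hA.summable_inner_amplitude.tsum_add hB.summable_inner_amplitude]
  exact tsum_congr fun k => by rw [app_add (hA.mem k) (hB.mem k), inner_add_right]

theorem moment_add_left (hA : ρ.FiniteSecondMoment A) (hB : ρ.FiniteSecondMoment B)
    (hC : ρ.FiniteSecondMoment C) : ρ.moment (A + B) C = ρ.moment A C + ρ.moment B C := by
  rw [moment, moment, moment, ← (hA.summable_inner hC).tsum_add (hB.summable_inner hC)]
  exact tsum_congr fun k => by rw [app_add (hA.mem k) (hB.mem k), inner_add_left]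

theorem moment_add_right (hA : ρ.FiniteSecondMoment A) (hB : ρ.FiniteSecondMoment B)
    (hC : ρ.FiniteSecondMoment C) : ρ.moment C (A + B) = ρ.moment C A + ρ.moment C B := by
  rw [moment, moment, moment, ← (hC.summable_inner hA).tsum_add (hC.summable_inner hB)]
  exact tsum_congr fun k => by rw [app_add (hA.mem k) (hB.mem k), inner_add_right]

theorem cov_add_left (hA : ρ.FiniteSecondMoment A) (hB : ρ.FiniteSecondMoment B)
    (hC : ρ.FiniteSecondMoment C) : ρ.cov (A + B) C = ρ.cov A C + ρ.cov B C := by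
  rw [cov_eq_moment (hA.add hB) hC, cov_eq_moment hA hC, cov_eq_moment hB hC, expect_add hA hB,
    moment_add_left hA hB hC, moment_add_right hA hB hC]
  ring

theorem cov_neg_left (ρ : MixedState ι H) (A B : H →ₗ.[ℂ] H) : ρ.cov (-A) B = -ρ.cov A B := by
  simp only [cov, expect, app_neg, inner_neg_left, inner_neg_right, ← neg_add, mul_neg, tsum_neg]
  ring

theorem cov_sub_right (hA : ρ.FiniteSecondMoment A) (hB : ρ.FiniteSecondMoment B)
    (hC : ρ.FiniteSecondMoment C) : ρ.cov C (A - B) = ρ.cov C A - ρ.cov C B := by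
  rw [sub_eq_add_neg, cov_comm, cov_add_left hA hB.neg hC, cov_neg_left, cov_comm _ A,
    cov_comm _ B, sub_eq_add_neg]

theorem var_add (hA : ρ.FiniteSecondMoment A) (hB : ρ.FiniteSecondMoment B) :
    ρ.var (A + B) = ρ.var A + 2 * ρ.cov A B + ρ.var B := by
  rw [var, cov_add_left hA hB (hA.add hB), cov_comm _ A, cov_comm _ B, cov_add_left hA hB hA,
    cov_add_left hA hB hB, cov_comm _ B A, var, var]
  ring

end Moments

section Map

variable {ι H : Type*} [NormedAddCommGroup H] [InnerProductSpace ℂ H] {ρ : MixedState ι H}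
  {A : H →ₗ.[ℂ] H}

theorem amplitude_map (ρ : MixedState ι H) (S : H ≃ₗᵢ[ℂ] H) (k : ι) :
    (ρ.map S).amplitude k = S (ρ.amplitude k) :=
  (map_smul S _ _).symm

variable [CompleteSpace H]

theorem finiteSecondMoment_map (S : H ≃ₗᵢ[ℂ] H) :
    (ρ.map S).FiniteSecondMoment A ↔ ρ.FiniteSecondMoment (heisenberg (S : H →L[ℂ] H) A) := by
  simp only [finiteSecondMoment_iff, amplitude_map, app_heisenberg_isometry, S.symm.norm_map]
  rfl

theorem expect_map (ρ : MixedState ι H) (S : H ≃ₗᵢ[ℂ] H) (A : H →ₗ.[ℂ] H) :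
    (ρ.map S).expect A = ρ.expect (heisenberg (S : H →L[ℂ] H) A) := by
  simp only [expect_eq_tsum, amplitude_map, app_heisenberg_isometry]
  exact tsum_congr fun k => S.inner_map_eq_flip _ _

theorem cov_map (ρ : MixedState ι H) (S : H ≃ₗᵢ[ℂ] H) (A B : H →ₗ.[ℂ] H) :
    (ρ.map S).cov A B =
      ρ.cov (heisenberg (S : H →L[ℂ] H) A) (heisenberg (S : H →L[ℂ] H) B) := by
  simp only [cov, expect_map, app_heisenberg_isometry, S.symm.inner_map_map]
  rfl

end Map

end MixedState

/-! ### Operators of the weight -/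

theorem coeFn_app_mulOp {g : ℝ → ℂ} {ψ : WeightSpace} (hψ : ψ ∈ (mulOp g).domain) :
    ⇑(app (mulOp g) ψ) =ᵐ[volume] fun E => g E * ψ E := by
  rw [app_of_mem hψ]
  exact MemLp.coeFn_toLp (memLp_of_mem_mulDomain hψ)

theorem mulOp_isFormalAdjoint_self (g : ℝ → ℝ) :
    (mulOp fun E => (g E : ℂ)).IsFormalAdjoint (mulOp fun E => (g E : ℂ)) := by
  intro x y
  rw [← app_of_mem x.2, ← app_of_mem y.2, L2.inner_def, L2.inner_def]
  refine integral_congr_ae ?_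
  filter_upwards [coeFn_app_mulOp x.2, coeFn_app_mulOp y.2] with E hx hy
  rw [hx, hy, RCLike.inner_apply, RCLike.inner_apply, map_mul, Complex.conj_ofReal]
  ring

theorem weightH_isFormalAdjoint_self : weightH.IsFormalAdjoint weightH :=
  mulOp_isFormalAdjoint_self id

theorem coeFn_displacement (a : ℝ) (ψ : WeightSpace) :
    displacement a ψ =ᵐ[volume] fun E => ψ (E - a) :=
  Lp.coeFn_compMeasurePreserving ψ (measurePreserving_sub_right volume a)

theorem displacement_displacement (a b : ℝ) (ψ : WeightSpace) :
    displacement a (displacement b ψ) = displacement (a + b) ψ := by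
  have ha := (measurePreserving_sub_right (volume : Measure ℝ) a).quasiMeasurePreserving
  refine Lp.ext ?_
  filter_upwards [coeFn_displacement a (displacement b ψ), ha.ae_eq_comp (coeFn_displacement b ψ),
    coeFn_displacement (a + b) ψ] with E hab hb hsum
  rw [hab, hsum, ← sub_sub]
  exact hb

theorem displacement_zero (ψ : WeightSpace) : displacement 0 ψ = ψ := by
  refine Lp.ext ?_
  filter_upwards [coeFn_displacement 0 ψ] with E hE
  rw [hE, sub_zero]

theorem displacement_symm_apply (a : ℝ) (ψ : WeightSpace) :
    (displacement a).symm ψ = displacement (-a) ψ := by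
  rw [LinearIsometryEquiv.symm_apply_eq, displacement_displacement, add_neg_cancel,
    displacement_zero]

theorem mul_displacement_ae_eq {ψ : WeightSpace} (hψ : ψ ∈ weightH.domain) (a : ℝ) :
    (fun E : ℝ => (E : ℂ) * displacement a ψ E) =ᵐ[volume]
      displacement a (app weightH ψ + (a : ℂ) • ψ) := by
  have ha := (measurePreserving_sub_right (volume : Measure ℝ) a).quasiMeasurePreserving
  filter_upwards [coeFn_displacement a ψ, coeFn_displacement a (app weightH ψ + (a : ℂ) • ψ),
    ha.ae (coeFn_app_mulOp hψ), ha.ae (Lp.coeFn_add (app weightH ψ) ((a : ℂ) • ψ)),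
    ha.ae (Lp.coeFn_smul (a : ℂ) ψ)] with E hψE hE hH hadd hsmul
  rw [hψE, hE, hadd, Pi.add_apply, hsmul, Pi.smul_apply, weightH, hH, smul_eq_mul]
  push_cast
  ring

theorem displacement_mem_weightH_domain {ψ : WeightSpace} (a : ℝ) :
    displacement a ψ ∈ weightH.domain ↔ ψ ∈ weightH.domain := by
  have himp {φ : WeightSpace} (b : ℝ) (hφ : φ ∈ weightH.domain) :
      displacement b φ ∈ weightH.domain :=
    (memLp_congr_ae (mul_displacement_ae_eq hφ b)).2 (Lp.memLp _)
  refine ⟨fun h => ?_, himp a⟩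
  simpa only [displacement_displacement, neg_add_cancel, displacement_zero] using himp (-a) h

theorem app_weightH_displacement {ψ : WeightSpace} (hψ : ψ ∈ weightH.domain) (a : ℝ) :
    app weightH (displacement a ψ) = displacement a (app weightH ψ + (a : ℂ) • ψ) :=
  Lp.ext ((coeFn_app_mulOp ((displacement_mem_weightH_domain a).2 hψ)).trans
    (mul_displacement_ae_eq hψ a))

/-! ### Operators of the composite system -/

section Composite

variable {n : Type*} [Fintype n]

theorem onSystem_apply (M : Matrix n n ℂ) (Ψ : TotalSpace n) (i : n) :
    onSystem M Ψ i = ∑ j, M i j • Ψ j := by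
  simp [onSystem]

theorem onSystem_sub (M N : Matrix n n ℂ) : onSystem (M - N) = onSystem M - onSystem N := by
  ext1 Ψ
  ext1 i
  simp [onSystem_apply, sub_smul, Finset.sum_sub_distrib]

theorem onSystem_mul (M N : Matrix n n ℂ) : onSystem (M * N) = onSystem M ∘L onSystem N := by
  ext1 Ψ
  ext1 i
  simp only [ContinuousLinearMap.comp_apply, onSystem_apply, Matrix.mul_apply, Finset.sum_smul,
    Finset.smul_sum, smul_smul]
  exact Finset.sum_comm

theorem adjoint_onSystem (M : Matrix n n ℂ) :
    ContinuousLinearMap.adjoint (onSystem M) = onSystem M.conjTranspose := by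
  refine ((ContinuousLinearMap.eq_adjoint_iff _ _).2 fun Φ Ψ => ?_).symm
  simp only [PiLp.inner_apply, onSystem_apply, sum_inner, inner_sum, inner_smul_left,
    inner_smul_right, Matrix.conjTranspose_apply, RCLike.star_def, Complex.conj_conj]
  exact Finset.sum_comm

theorem app_onWeight_apply {A : WeightSpace →ₗ.[ℂ] WeightSpace} {Ψ : TotalSpace n}
    (hΨ : Ψ ∈ (onWeight A).domain) (i : n) : app (onWeight A) Ψ i = app A (Ψ i) := by
  rw [app_of_mem hΨ, app_of_mem (hΨ i)]
  rfl

theorem onSystem_mem_domain_onWeight {A : WeightSpace →ₗ.[ℂ] WeightSpace} {Ψ : TotalSpace n}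
    (hΨ : Ψ ∈ (onWeight A).domain) (M : Matrix n n ℂ) : onSystem M Ψ ∈ (onWeight A).domain :=
  fun i => by
    rw [onSystem_apply]
    exact Submodule.sum_mem _ fun j _ => A.domain.smul_mem _ (hΨ j)

theorem app_onWeight_onSystem {A : WeightSpace →ₗ.[ℂ] WeightSpace} {Ψ : TotalSpace n}
    (hΨ : Ψ ∈ (onWeight A).domain) (M : Matrix n n ℂ) :
    app (onWeight A) (onSystem M Ψ) = onSystem M (app (onWeight A) Ψ) := by
  ext1 i
  rw [app_onWeight_apply (onSystem_mem_domain_onWeight hΨ M), onSystem_apply, onSystem_apply,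
    app_sum _ fun j _ => A.domain.smul_mem _ (hΨ j)]
  simp only [app_smul, app_onWeight_apply hΨ]

theorem controlS_apply (ε : n → ℝ) (Ψ : TotalSpace n) (i : n) :
    controlS ε Ψ i = displacement (ε i) (Ψ i) := rfl

theorem controlS_symm_apply (ε : n → ℝ) (Ψ : TotalSpace n) (i : n) :
    (controlS ε).symm Ψ i = displacement (-ε i) (Ψ i) :=
  displacement_symm_apply (ε i) (Ψ i)

theorem controlS_symm (ε : n → ℝ) : (controlS ε).symm = controlS (-ε) := by
  ext1 Ψ
  ext1 i
  exact controlS_symm_apply ε Ψ i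

variable [DecidableEq n]

theorem onSystem_one : onSystem (1 : Matrix n n ℂ) = 1 := by
  ext1 Ψ
  ext1 i
  simp [onSystem_apply, Matrix.one_apply]

theorem onSystem_conjTranspose_apply_onSystem {V : Matrix n n ℂ}
    (hV : V ∈ Matrix.unitaryGroup n ℂ) (Ψ : TotalSpace n) :
    onSystem V.conjTranspose (onSystem V Ψ) = Ψ := by
  rw [← ContinuousLinearMap.comp_apply, ← onSystem_mul, ← Matrix.star_eq_conjTranspose,
    Matrix.mem_unitaryGroup_iff'.1 hV, onSystem_one, one_apply_eq_self]

theorem heisenberg_onSystem_onWeight {V : Matrix n n ℂ} (hV : V ∈ Matrix.unitaryGroup n ℂ)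
    (A : WeightSpace →ₗ.[ℂ] WeightSpace) :
    heisenberg (onSystem V) (onWeight A) = onWeight A := by
  have hdom : (heisenberg (onSystem V) (onWeight A)).domain = (onWeight A).domain := by
    refine Submodule.ext fun Ψ => ⟨fun h => ?_, fun h => onSystem_mem_domain_onWeight h V⟩
    rw [← onSystem_conjTranspose_apply_onSystem hV Ψ]
    exact onSystem_mem_domain_onWeight h _
  refine ext_app hdom fun Ψ hΨ => ?_
  rw [app_heisenberg, app_onWeight_onSystem (hdom ▸ hΨ), adjoint_onSystem,
    onSystem_conjTranspose_apply_onSystem hV]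

theorem onSystem_systemH_apply (ε : n → ℝ) (Ψ : TotalSpace n) (i : n) :
    onSystem (systemH ε) Ψ i = (ε i : ℂ) • Ψ i := by
  simp [onSystem_apply, systemH, Matrix.diagonal_apply]

theorem heisenberg_controlS_systemH (ε : n → ℝ) (ε' : n → ℝ) :
    heisenberg (controlS ε : TotalSpace n →L[ℂ] TotalSpace n)
      (ofBounded (onSystem (systemH ε'))) = ofBounded (onSystem (systemH ε')) := by
  refine ext_app rfl fun Ψ _ => ?_
  rw [app_heisenberg_isometry, app_ofBounded, app_ofBounded,
    LinearIsometryEquiv.symm_apply_eq]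
  ext1 i
  rw [onSystem_systemH_apply, controlS_apply, controlS_apply, onSystem_systemH_apply, map_smul]

theorem heisenberg_controlS_onWeight_weightH (ε : n → ℝ) :
    heisenberg (controlS ε : TotalSpace n →L[ℂ] TotalSpace n) (onWeight weightH) =
      onWeight weightH + ofBounded (onSystem (systemH ε)) := by
  have hmem (Ψ : TotalSpace n) :
      controlS ε Ψ ∈ (onWeight weightH).domain ↔ Ψ ∈ (onWeight weightH).domain :=
    forall_congr' fun i => displacement_mem_weightH_domain (ε i)
  refine ext_app (Submodule.ext fun Ψ => (hmem Ψ).trans (and_iff_left trivial).symm) fun Ψ hΨ => ?_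
  replace hΨ : controlS ε Ψ ∈ (onWeight weightH).domain := hΨ
  have hΨ' := (hmem Ψ).1 hΨ
  rw [app_add hΨ' Submodule.mem_top, app_heisenberg_isometry, app_ofBounded,
    LinearIsometryEquiv.symm_apply_eq]
  ext1 i
  rw [app_onWeight_apply hΨ, controlS_apply, controlS_apply, app_weightH_displacement (hΨ' i),
    PiLp.add_apply, app_onWeight_apply hΨ', onSystem_systemH_apply]

theorem heisenberg_controlS_symm_onWeight_weightH (ε : n → ℝ) :
    heisenberg ((controlS ε).symm : TotalSpace n →L[ℂ] TotalSpace n) (onWeight weightH) =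
      onWeight weightH - ofBounded (onSystem (systemH ε)) := by
  have hneg : systemH (-ε) = -systemH ε := by
    simp [systemH, Matrix.diagonal_neg]
  have hsystem : onSystem (-systemH ε) = -onSystem (systemH ε) := by
    ext1 Ψ
    ext1 i
    simp [onSystem_apply]
  rw [controlS_symm, heisenberg_controlS_onWeight_weightH, hneg, hsystem, ofBounded_neg,
    sub_eq_add_neg]

theorem heisenberg_onSystem_systemH (ε : n → ℝ) (V : Matrix n n ℂ) :
    heisenberg (onSystem V) (ofBounded (onSystem (systemH ε))) =
      ofBounded (onSystem (finalH ε V)) := by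
  rw [heisenberg_ofBounded, adjoint_onSystem, finalH, onSystem_mul, onSystem_mul,
    ContinuousLinearMap.comp_assoc]

theorem heisenberg_controlS_workOp (ε : n → ℝ) (V : Matrix n n ℂ) :
    heisenberg (controlS ε : TotalSpace n →L[ℂ] TotalSpace n)
        (ofBounded (onSystem (workOp ε V))) =
      ofBounded (onSystem (systemH ε)) -
        heisenberg (controlS ε : TotalSpace n →L[ℂ] TotalSpace n)
          (ofBounded (onSystem (finalH ε V))) := by
  rw [workOp, onSystem_sub, ofBounded_sub, heisenberg_sub, heisenberg_controlS_systemH]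

theorem heisenberg_totalU_onWeight_weightH (ε : n → ℝ) {V : Matrix n n ℂ}
    (hV : V ∈ Matrix.unitaryGroup n ℂ) :
    heisenberg (totalU ε V) (onWeight weightH) = onWeight weightH +
      heisenberg (controlS ε : TotalSpace n →L[ℂ] TotalSpace n)
        (ofBounded (onSystem (workOp ε V))) := by
  rw [totalU, heisenberg_comp, heisenberg_comp, heisenberg_controlS_symm_onWeight_weightH,
    heisenberg_sub, heisenberg_onSystem_onWeight hV, heisenberg_onSystem_systemH, heisenberg_sub,
    heisenberg_controlS_onWeight_weightH, heisenberg_controlS_workOp, add_sub_assoc]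

theorem heisenberg_controlS_systemH_sub_weightH (ε : n → ℝ) :
    heisenberg (controlS ε : TotalSpace n →L[ℂ] TotalSpace n)
      (ofBounded (onSystem (systemH ε)) - onWeight weightH) = -onWeight weightH := by
  rw [heisenberg_sub, heisenberg_controlS_systemH, heisenberg_controlS_onWeight_weightH,
    sub_add_eq_sub_sub_swap, ← ofBounded_sub, sub_self, ofBounded_zero, zero_sub]

end Composite

/-! ### Moments in product states and marginals -/

section ProductStates

variable {n κ ι : Type*}

theorem tensor_mem_domain_onWeight {A : WeightSpace →ₗ.[ℂ] WeightSpace} {ψ : WeightSpace}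
    (hψ : ψ ∈ A.domain) (v : EuclideanSpace ℂ n) : tensor v ψ ∈ (onWeight A).domain :=
  fun _ => A.domain.smul_mem _ hψ

variable [Fintype n]

theorem inner_tensor (v w : EuclideanSpace ℂ n) (φ ψ : WeightSpace) :
    inner ℂ (tensor v φ) (tensor w ψ) = inner ℂ v w * inner ℂ φ ψ := by
  simp only [PiLp.inner_apply, tensor, inner_smul_left, inner_smul_right, Finset.sum_mul,
    RCLike.inner_apply]
  exact Finset.sum_congr rfl fun i _ => by ring

theorem app_onWeight_tensor {A : WeightSpace →ₗ.[ℂ] WeightSpace} {ψ : WeightSpace}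
    (hψ : ψ ∈ A.domain) (v : EuclideanSpace ℂ n) :
    app (onWeight A) (tensor v ψ) = tensor v (app A ψ) := by
  ext1 i
  rw [app_onWeight_apply (tensor_mem_domain_onWeight hψ v)]
  exact app_smul A (v i) ψ

theorem amplitude_prodState (ρS : MixedState κ (EuclideanSpace ℂ n))
    (ρW : MixedState ι WeightSpace) (k : κ × ι) :
    (prodState ρS ρW).amplitude k = tensor (ρS.amplitude k.1) (ρW.amplitude k.2) := by
  ext1 i
  simp only [MixedState.amplitude, prodState, tensor, PiLp.smul_apply,
    Real.sqrt_mul (ρS.p_nonneg _), Complex.ofReal_mul, smul_smul, smul_eq_mul]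
  congr 1
  ring

theorem app_onWeight_amplitude_prodState (ρS : MixedState κ (EuclideanSpace ℂ n))
    {ρW : MixedState ι WeightSpace} {A : WeightSpace →ₗ.[ℂ] WeightSpace}
    (hA : ρW.FiniteSecondMoment A) (k : κ × ι) :
    app (onWeight A) ((prodState ρS ρW).amplitude k) =
      tensor (ρS.amplitude k.1) (app A (ρW.amplitude k.2)) := by
  rw [amplitude_prodState, app_onWeight_tensor (hA.mem k.2)]

theorem densityMatrix_apply (ρS : MixedState κ (EuclideanSpace ℂ n)) (i j : n) :
    densityMatrix ρS i j = ∑' k, ρS.amplitude k i * conj (ρS.amplitude k j) := by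
  refine tsum_congr fun k => ?_
  simp only [MixedState.amplitude, PiLp.smul_apply, smul_eq_mul, map_mul, Complex.conj_ofReal,
    ← ρS.sqrt_p_mul_self k]
  ring

theorem finiteSecondMoment_prodState_onWeight (ρS : MixedState κ (EuclideanSpace ℂ n))
    {ρW : MixedState ι WeightSpace} {A : WeightSpace →ₗ.[ℂ] WeightSpace}
    (hA : ρW.FiniteSecondMoment A) : (prodState ρS ρW).FiniteSecondMoment (onWeight A) := by
  refine MixedState.finiteSecondMoment_iff.2 ⟨fun k => ?_, ?_⟩
  · rw [amplitude_prodState]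
    exact tensor_mem_domain_onWeight (hA.mem k.2) _
  have hsum := ρS.hasSum_norm_sq_amplitude.summable.mul_of_nonneg hA.summable
    (fun _ => sq_nonneg _) fun _ => sq_nonneg _
  refine hsum.congr fun k => ?_
  rw [app_onWeight_amplitude_prodState ρS hA, norm_tensor, mul_pow]

theorem MixedState.hasSum_inner_self_amplitude {H : Type*} [NormedAddCommGroup H]
    [InnerProductSpace ℂ H] (ρ : MixedState ι H) :
    HasSum (fun k => inner ℂ (ρ.amplitude k) (ρ.amplitude k)) 1 := by
  simpa only [inner_self_eq_norm_sq_to_K, Complex.coe_algebraMap, Complex.ofReal_pow,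
    Complex.ofReal_one] using Complex.hasSum_ofReal.2 ρ.hasSum_norm_sq_amplitude

theorem expect_prodState_onWeight (ρS : MixedState κ (EuclideanSpace ℂ n))
    {ρW : MixedState ι WeightSpace} {A : WeightSpace →ₗ.[ℂ] WeightSpace}
    (hA : ρW.FiniteSecondMoment A) : (prodState ρS ρW).expect (onWeight A) = ρW.expect A := by
  simp only [MixedState.expect_eq_tsum, app_onWeight_amplitude_prodState ρS hA]
  simp only [amplitude_prodState, inner_tensor]
  rw [← tsum_mul_tsum_of_summable_norm ρS.hasSum_inner_self_amplitude.summable.norm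
    hA.summable_inner_amplitude.norm, ρS.hasSum_inner_self_amplitude.tsum_eq, one_mul]

end ProductStates

section Marginals

variable {n ι : Type*} [Fintype n] (ρ : MixedState ι (TotalSpace n))

theorem reducedS_apply (i j : n) :
    reducedS ρ i j = ∑' k, inner ℂ (ρ.amplitude k j) (ρ.amplitude k i) :=
  tsum_congr fun k => (ρ.inner_sqrt_smul k _ _).symm

theorem inner_onSystem_right (M : Matrix n n ℂ) (Φ Ψ : TotalSpace n) :
    inner ℂ Φ (onSystem M Ψ) = ∑ i, ∑ j, M i j * inner ℂ (Φ i) (Ψ j) := by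
  simp only [PiLp.inner_apply, onSystem_apply, inner_sum, inner_smul_right]

theorem summable_inner_amplitude_apply {E : Type*} [NormedAddCommGroup E]
    [InnerProductSpace ℂ E] (ρ : MixedState ι (PiLp 2 fun _ : n => E)) (i j : n) :
    Summable fun k => inner ℂ (ρ.amplitude k j) (ρ.amplitude k i) := by
  have hcomp (i : n) : Summable fun k => ‖ρ.amplitude k i‖ ^ 2 :=
    .of_nonneg_of_le (fun _ => sq_nonneg _)
      (fun k => pow_le_pow_left₀ (norm_nonneg _) (PiLp.norm_apply_le _ i) 2)
      ρ.hasSum_norm_sq_amplitude.summable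
  exact summable_inner_of_summable_norm_sq (hcomp j) (hcomp i)

theorem expect_onSystem (M : Matrix n n ℂ) :
    ρ.expect (ofBounded (onSystem M)) = matExpect (reducedS ρ) M := by
  have hsum (i j : n) := (summable_inner_amplitude_apply ρ j i).mul_left (M i j)
  simp only [MixedState.expect_eq_tsum, app_ofBounded, inner_onSystem_right, matExpect,
    Matrix.trace, Matrix.diag_apply, Matrix.mul_apply, reducedS_apply, ← tsum_mul_left]
  rw [Summable.tsum_finsetSum fun i _ => summable_sum fun j _ => hsum i j]
  exact Finset.sum_congr rfl fun i _ => Summable.tsum_finsetSum fun j _ => hsum i j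

theorem moment_onSystem {M : Matrix n n ℂ} (hM : M.IsHermitian) (N : Matrix n n ℂ) :
    ρ.moment (ofBounded (onSystem M)) (ofBounded (onSystem N)) =
      matExpect (reducedS ρ) (M * N) := by
  simp only [← expect_onSystem, MixedState.expect_eq_tsum, MixedState.moment, app_ofBounded,
    onSystem_mul, ContinuousLinearMap.comp_apply]
  refine tsum_congr fun k => ?_
  rw [← ContinuousLinearMap.adjoint_inner_right, adjoint_onSystem, hM.eq]

theorem var_onSystem {M : Matrix n n ℂ} (hM : M.IsHermitian) :
    ρ.var (ofBounded (onSystem M)) = matVar (reducedS ρ) M := by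
  have hfin := ρ.finiteSecondMoment_ofBounded (onSystem M)
  rw [MixedState.var, MixedState.cov_eq_moment hfin hfin, moment_onSystem ρ hM, expect_onSystem,
    matVar, matCov]
  simp only [matExpect, add_mul, Matrix.trace_add]

end Marginals

/-! ### Correlations of the displaced weight with the system -/

section DisplacedCorrelations

variable {n κ ι : Type*} [Fintype n]

theorem heisenberg_controlS_onSystem_apply (ε : n → ℝ) (M : Matrix n n ℂ) (Ψ : TotalSpace n)
    (i : n) :
    app (heisenberg (controlS ε : TotalSpace n →L[ℂ] TotalSpace n) (ofBounded (onSystem M))) Ψ i =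
      ∑ j, M i j • displacement (ε j - ε i) (Ψ j) := by
  simp only [app_heisenberg_isometry, app_ofBounded, controlS_symm_apply, onSystem_apply,
    controlS_apply, map_sum, map_smul, displacement_displacement, neg_add_eq_sub]

theorem inner_heisenberg_controlS_onSystem_left (ε : n → ℝ) {M : Matrix n n ℂ}
    (hM : M.IsHermitian) (Φ Ψ : TotalSpace n) :
    inner ℂ (app (heisenberg (controlS ε : TotalSpace n →L[ℂ] TotalSpace n)
        (ofBounded (onSystem M))) Φ) Ψ =
      inner ℂ Φ (app (heisenberg (controlS ε : TotalSpace n →L[ℂ] TotalSpace n)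
        (ofBounded (onSystem M))) Ψ) := by
  simp only [app_heisenberg_isometry, app_ofBounded]
  rw [(controlS ε).symm.inner_map_eq_flip, (controlS ε).symm_symm,
    ← (controlS ε).inner_map_eq_flip, ← ContinuousLinearMap.adjoint_inner_right,
    adjoint_onSystem, hM.eq]

theorem inner_tensor_heisenberg_controlS_onSystem (ε : n → ℝ) (M : Matrix n n ℂ)
    (v : EuclideanSpace ℂ n) (φ ψ : WeightSpace) :
    inner ℂ (tensor v φ) (app (heisenberg (controlS ε : TotalSpace n →L[ℂ] TotalSpace n)
        (ofBounded (onSystem M))) (tensor v ψ)) =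
      ∑ i, ∑ j, M i j * (v j * conj (v i) * inner ℂ φ (displacement (ε j - ε i) ψ)) := by
  simp only [PiLp.inner_apply, heisenberg_controlS_onSystem_apply, tensor, inner_sum, map_smul,
    inner_smul_left, inner_smul_right]
  exact Finset.sum_congr rfl fun i _ => Finset.sum_congr rfl fun j _ => by ring

theorem summable_amplitude_mul_conj (ρS : MixedState κ (EuclideanSpace ℂ n)) (i j : n) :
    Summable fun k => ρS.amplitude k i * conj (ρS.amplitude k j) := by
  simpa only [RCLike.inner_apply] using summable_inner_amplitude_apply ρS i j

theorem tsum_inner_tensor_heisenberg_controlS_onSystem (ε : n → ℝ) (M : Matrix n n ℂ)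
    (ρS : MixedState κ (EuclideanSpace ℂ n)) {φ ψ : ι → WeightSpace}
    (hφ : Summable fun l => ‖φ l‖ ^ 2) (hψ : Summable fun l => ‖ψ l‖ ^ 2) :
    ∑' k : κ × ι, inner ℂ (tensor (ρS.amplitude k.1) (φ k.2))
        (app (heisenberg (controlS ε : TotalSpace n →L[ℂ] TotalSpace n)
          (ofBounded (onSystem M))) (tensor (ρS.amplitude k.1) (ψ k.2))) =
      ∑ i, ∑ j, M i j * (densityMatrix ρS j i *
        ∑' l, inner ℂ (φ l) (displacement (ε j - ε i) (ψ l))) := by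
  have hsys (i j : n) := (summable_amplitude_mul_conj ρS j i).norm
  have hweight (i j : n) : Summable fun l => ‖inner ℂ (φ l) (displacement (ε j - ε i) (ψ l))‖ :=
    (summable_inner_of_summable_norm_sq hφ
      (by simpa only [LinearIsometryEquiv.norm_map] using hψ)).norm
  have hsum (i j : n) := (summable_mul_of_summable_norm (hsys i j) (hweight i j)).mul_left (M i j)
  simp only [inner_tensor_heisenberg_controlS_onSystem, densityMatrix_apply]
  rw [Summable.tsum_finsetSum fun i _ => summable_sum fun j _ => hsum i j]
  refine Finset.sum_congr rfl fun i _ => ?_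
  rw [Summable.tsum_finsetSum fun j _ => hsum i j]
  refine Finset.sum_congr rfl fun j _ => ?_
  rw [tsum_mul_left, tsum_mul_tsum_of_summable_norm (hsys i j) (hweight i j)]

/-- The mean displacement `Tr[Γ_δ ρ_W]`. -/
def displacementMean (ρW : MixedState ι WeightSpace) (δ : ℝ) : ℂ :=
  ∑' l, inner ℂ (ρW.amplitude l) (displacement δ (ρW.amplitude l))

/-- The symmetrised correlation `½ Tr[(H_W Γ_δ + Γ_δ H_W) ρ_W]`, with both products read as
quadratic forms. -/
def energyDisplacementMean (ρW : MixedState ι WeightSpace) (δ : ℝ) : ℂ :=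
  1 / 2 * (∑' l, inner ℂ (app weightH (ρW.amplitude l)) (displacement δ (ρW.amplitude l)) +
    ∑' l, inner ℂ (ρW.amplitude l) (displacement δ (app weightH (ρW.amplitude l))))

/-- The symmetrised covariance of `H_W` and `Γ_δ` in the state `ρ_W`. -/
def energyDisplacementCov (ρW : MixedState ι WeightSpace) (δ : ℝ) : ℂ :=
  energyDisplacementMean ρW δ - ρW.expect weightH * displacementMean ρW δ

theorem displacementMean_zero (ρW : MixedState ι WeightSpace) : displacementMean ρW 0 = 1 := by
  simpa only [displacementMean, displacement_zero] using ρW.hasSum_inner_self_amplitude.tsum_eq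

theorem energyDisplacementMean_zero {ρW : MixedState ι WeightSpace}
    (hρW : ρW.FiniteSecondMoment weightH) :
    energyDisplacementMean ρW 0 = ρW.expect weightH := by
  have hsymm (l : ι) : inner ℂ (app weightH (ρW.amplitude l)) (ρW.amplitude l) =
      inner ℂ (ρW.amplitude l) (app weightH (ρW.amplitude l)) := by
    rw [app_of_mem (hρW.mem l)]
    exact weightH_isFormalAdjoint_self ⟨_, hρW.mem l⟩ ⟨_, hρW.mem l⟩
  simp only [energyDisplacementMean, displacement_zero, hsymm, ← MixedState.expect_eq_tsum]
  ring

theorem energyDisplacementCov_zero {ρW : MixedState ι WeightSpace}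
    (hρW : ρW.FiniteSecondMoment weightH) : energyDisplacementCov ρW 0 = 0 := by
  rw [energyDisplacementCov, energyDisplacementMean_zero hρW, displacementMean_zero, mul_one,
    sub_self]

theorem finiteSecondMoment_heisenberg_controlS_onSystem (ε : n → ℝ) (M : Matrix n n ℂ)
    (ρ : MixedState ι (TotalSpace n)) :
    ρ.FiniteSecondMoment (heisenberg (controlS ε : TotalSpace n →L[ℂ] TotalSpace n)
      (ofBounded (onSystem M))) :=
  (MixedState.finiteSecondMoment_map _).1 (MixedState.finiteSecondMoment_ofBounded _ _)

theorem cov_weightH_heisenberg_controlS_onSystem (ε : n → ℝ) {M : Matrix n n ℂ}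
    (hM : M.IsHermitian) (ρS : MixedState κ (EuclideanSpace ℂ n)) {ρW : MixedState ι WeightSpace}
    (hρW : ρW.FiniteSecondMoment weightH) :
    (prodState ρS ρW).cov (onWeight weightH)
        (heisenberg (controlS ε : TotalSpace n →L[ℂ] TotalSpace n) (ofBounded (onSystem M))) =
      ∑ i, ∑ j, M i j * (densityMatrix ρS j i * energyDisplacementCov ρW (ε j - ε i)) := by
  have hφ := ρW.hasSum_norm_sq_amplitude.summable
  rw [MixedState.cov_eq_moment (finiteSecondMoment_prodState_onWeight ρS hρW)
      (finiteSecondMoment_heisenberg_controlS_onSystem ε M _),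
    expect_prodState_onWeight ρS hρW]
  simp only [MixedState.moment, MixedState.expect_eq_tsum _ (heisenberg _ _),
    inner_heisenberg_controlS_onSystem_left ε hM, app_onWeight_amplitude_prodState ρS hρW]
  simp only [amplitude_prodState]
  rw [tsum_inner_tensor_heisenberg_controlS_onSystem ε M ρS hρW.summable hφ,
    tsum_inner_tensor_heisenberg_controlS_onSystem ε M ρS hφ hρW.summable,
    tsum_inner_tensor_heisenberg_controlS_onSystem ε M ρS hφ hφ]
  simp only [energyDisplacementCov, energyDisplacementMean, displacementMean, Finset.mul_sum,
    ← Finset.sum_add_distrib, ← Finset.sum_sub_distrib]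
  exact Finset.sum_congr rfl fun i _ => Finset.sum_congr rfl fun j _ => by ring

end DisplacedCorrelations

/-! ### Energy change and variance change of the weight -/

section EnergyStatistics

variable {n κ ι : Type*} [DecidableEq n]

theorem systemH_isHermitian (ε : n → ℝ) : (systemH ε).IsHermitian :=
  Matrix.isHermitian_diagonal_of_self_adjoint _ (funext fun i => Complex.conj_ofReal (ε i))

variable [Fintype n]

theorem workOp_isHermitian (ε : n → ℝ) (V : Matrix n n ℂ) : (workOp ε V).IsHermitian :=
  (systemH_isHermitian ε).sub (Matrix.isHermitian_conjTranspose_mul_mul V (systemH_isHermitian ε))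

variable (ε : n → ℝ) (V : Matrix n n ℂ) (ρS : MixedState κ (EuclideanSpace ℂ n))
  {ρW : MixedState ι WeightSpace} (hρW : ρW.FiniteSecondMoment weightH)
include hρW

theorem finiteSecondMoment_heisenberg_totalU (hV : V ∈ Matrix.unitaryGroup n ℂ) :
    (prodState ρS ρW).FiniteSecondMoment (heisenberg (totalU ε V) (onWeight weightH)) := by
  rw [heisenberg_totalU_onWeight_weightH ε hV]
  exact (finiteSecondMoment_prodState_onWeight ρS hρW).add
    (finiteSecondMoment_heisenberg_controlS_onSystem ε _ _)

theorem finiteSecondMoment_controlState_systemH_sub_weightH :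
    (controlState ε ρS ρW).FiniteSecondMoment
      (ofBounded (onSystem (systemH ε)) - onWeight weightH) := by
  rw [controlState, MixedState.finiteSecondMoment_map, heisenberg_controlS_systemH_sub_weightH]
  exact (finiteSecondMoment_prodState_onWeight ρS hρW).neg

theorem deltaE_eq_matExpect_workOp (hV : V ∈ Matrix.unitaryGroup n ℂ) :
    deltaE ε V ρS ρW = matExpect (controlMarginal ε ρS ρW) (workOp ε V) := by
  rw [deltaE, heisenberg_totalU_onWeight_weightH ε hV,
    MixedState.expect_add (finiteSecondMoment_prodState_onWeight ρS hρW)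
      (finiteSecondMoment_heisenberg_controlS_onSystem ε _ _),
    add_sub_cancel_left, ← MixedState.expect_map, ← controlState, expect_onSystem, controlMarginal]

theorem cov_weightH_systemH_eq_zero :
    (prodState ρS ρW).cov (onWeight weightH) (ofBounded (onSystem (systemH ε))) = 0 := by
  rw [← heisenberg_controlS_systemH ε ε,
    cov_weightH_heisenberg_controlS_onSystem ε (systemH_isHermitian ε) ρS hρW]
  refine Finset.sum_eq_zero fun i _ => Finset.sum_eq_zero fun j _ => ?_
  rcases eq_or_ne i j with rfl | hij
  · rw [sub_self, energyDisplacementCov_zero hρW, mul_zero, mul_zero]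
  · rw [systemH, Matrix.diagonal_apply_ne _ hij, zero_mul]

theorem fTerm_eq_cov_weightH_workOp :
    fTerm ε V ρS ρW = (prodState ρS ρW).cov (onWeight weightH)
      (heisenberg (controlS ε : TotalSpace n →L[ℂ] TotalSpace n)
        (ofBounded (onSystem (workOp ε V)))) := by
  rw [fTerm, controlState, MixedState.cov_map, heisenberg_controlS_systemH_sub_weightH,
    MixedState.cov_neg_left, heisenberg_controlS_workOp,
    MixedState.cov_sub_right (MixedState.finiteSecondMoment_ofBounded _ _)
      (finiteSecondMoment_heisenberg_controlS_onSystem ε _ _)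
      (finiteSecondMoment_prodState_onWeight ρS hρW),
    cov_weightH_systemH_eq_zero ε ρS hρW, zero_sub]

theorem deltaVar_eq_matVar_workOp_add (hV : V ∈ Matrix.unitaryGroup n ℂ) :
    deltaVar ε V ρS ρW =
      matVar (controlMarginal ε ρS ρW) (workOp ε V) + 2 * fTerm ε V ρS ρW := by
  rw [deltaVar, heisenberg_totalU_onWeight_weightH ε hV,
    MixedState.var_add (finiteSecondMoment_prodState_onWeight ρS hρW)
      (finiteSecondMoment_heisenberg_controlS_onSystem ε _ _),
    ← fTerm_eq_cov_weightH_workOp ε V ρS hρW, controlMarginal,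
    ← var_onSystem _ (workOp_isHermitian ε V), controlState]
  simp only [MixedState.var, MixedState.cov_map]
  ring

theorem fTerm_eq_sum :
    fTerm ε V ρS ρW = ∑ i, ∑ j, workOp ε V i j *
      (densityMatrix ρS j i * energyDisplacementCov ρW (ε j - ε i)) := by
  rw [fTerm_eq_cov_weightH_workOp ε V ρS hρW,
    cov_weightH_heisenberg_controlS_onSystem ε (workOp_isHermitian ε V) ρS hρW]

end EnergyStatistics

/-! ### Modulations -/

theorem norm_exp_I_mul (E s : ℝ) : ‖Complex.exp (Complex.I * E * s)‖ = 1 := by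
  rw [mul_assoc, ← Complex.ofReal_mul, Complex.norm_exp_I_mul_ofReal]

theorem hasDerivAt_exp_I_mul (E s : ℝ) :
    HasDerivAt (fun s : ℝ => Complex.exp (Complex.I * E * s))
      (Complex.exp (Complex.I * E * s) * (Complex.I * E)) s := by
  simpa using ((hasDerivAt_id (s : ℂ)).const_mul (Complex.I * E)).cexp.comp_ofReal

theorem norm_exp_I_mul_sub_le (E s r : ℝ) :
    ‖Complex.exp (Complex.I * E * s) - Complex.exp (Complex.I * E * r)‖ ≤ |E| * |s - r| := by
  have hle := convex_univ.norm_image_sub_le_of_norm_hasDerivWithin_le (C := |E|)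
    (fun s _ => (hasDerivAt_exp_I_mul E s).hasDerivWithinAt)
    (fun s _ => by simp [norm_exp_I_mul]) (Set.mem_univ r) (Set.mem_univ s)
  rwa [Real.norm_eq_abs] at hle

theorem mem_domain_mulOp_exp (s : ℝ) (ψ : WeightSpace) :
    ψ ∈ (mulOp fun E => Complex.exp (Complex.I * E * s)).domain :=
  (Lp.memLp ψ).of_le (AEStronglyMeasurable.mul (by fun_prop) (Lp.aestronglyMeasurable ψ))
    (.of_forall fun E => by rw [norm_mul, norm_exp_I_mul, one_mul])

/-- The modulation `e^{i s H_W}` as an everywhere defined isometry: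
`(e^{i s H_W} ψ)(E) = e^{i E s} ψ(E)`. -/
def modulation (s : ℝ) : WeightSpace →ₗᵢ[ℂ] WeightSpace where
  toLinearMap := (mulOp fun E => Complex.exp (Complex.I * E * s)).toFun ∘ₗ
    LinearMap.id.codRestrict _ (mem_domain_mulOp_exp s)
  norm_map' ψ := by
    rw [Lp.norm_def, Lp.norm_def]
    congr 1
    refine eLpNorm_congr_norm_ae ?_
    filter_upwards [MemLp.coeFn_toLp (memLp_of_mem_mulDomain (mem_domain_mulOp_exp s ψ))]
      with E hE
    exact (congrArg norm hE).trans (by rw [norm_mul, norm_exp_I_mul, one_mul])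

theorem app_mulOp_exp (s : ℝ) (ψ : WeightSpace) :
    app (mulOp fun E => Complex.exp (Complex.I * E * s)) ψ = modulation s ψ :=
  dif_pos (mem_domain_mulOp_exp s ψ)

theorem coeFn_modulation (s : ℝ) (ψ : WeightSpace) :
    modulation s ψ =ᵐ[volume] fun E : ℝ => Complex.exp (Complex.I * E * s) * ψ E :=
  app_mulOp_exp s ψ ▸ coeFn_app_mulOp (mem_domain_mulOp_exp s ψ)

theorem modulation_zero (ψ : WeightSpace) : modulation 0 ψ = ψ :=
  Lp.ext ((coeFn_modulation 0 ψ).trans (by simp))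

theorem inner_modulation_modulation (r s : ℝ) (φ ψ : WeightSpace) :
    inner ℂ (modulation r φ) (modulation s ψ) = inner ℂ φ (modulation (s - r) ψ) := by
  rw [L2.inner_def, L2.inner_def]
  refine integral_congr_ae ?_
  filter_upwards [coeFn_modulation r φ, coeFn_modulation s ψ, coeFn_modulation (s - r) ψ]
    with E hφ hψ hψ'
  have hexp : Complex.exp (Complex.I * E * s) * conj (Complex.exp (Complex.I * E * r)) =
      Complex.exp (Complex.I * E * (s - r : ℝ)) := by
    rw [← Complex.exp_conj, ← Complex.exp_add]
    simp only [map_mul, Complex.conj_I, Complex.conj_ofReal, Complex.ofReal_sub]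
    ring_nf
  rw [hφ, hψ, hψ', RCLike.inner_apply, RCLike.inner_apply, ← hexp, map_mul]
  ring

theorem hasDerivAt_modulation {ψ : WeightSpace} (hψ : ψ ∈ weightH.domain) (s : ℝ) :
    HasDerivAt (fun s => modulation s ψ) (Complex.I • modulation s (app weightH ψ)) s := by
  refine hasDerivAt_Lp_of_dominated (bound := fun E : ℝ => ‖app weightH ψ E‖)
    (f' := fun E : ℝ => Complex.exp (Complex.I * E * s) * (Complex.I * E) * ψ E)
    ENNReal.ofNat_ne_top (fun r => coeFn_modulation r ψ) ?_ (Lp.memLp _).norm ?_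
    (.of_forall fun E => (hasDerivAt_exp_I_mul E s).mul_const (ψ E))
  · filter_upwards [Lp.coeFn_smul Complex.I (modulation s (app weightH ψ)),
      coeFn_modulation s (app weightH ψ), coeFn_app_mulOp hψ] with E hsmul hmod hE
    rw [hsmul, Pi.smul_apply, hmod, weightH, hE, smul_eq_mul]
    ring
  · filter_upwards [coeFn_app_mulOp hψ] with E hE r
    rw [weightH, hE, ← sub_mul, norm_mul, norm_mul, Complex.norm_real, Real.norm_eq_abs,
      mul_right_comm |E|]
    exact mul_le_mul_of_nonneg_right (norm_exp_I_mul_sub_le E r s) (norm_nonneg _)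

/-! ### Products of Fourier transforms -/

theorem fourier_displacement_of_integrable {ψ : WeightSpace} (hψ : Integrable ψ) (a : ℝ) :
    (𝓕 (displacement a ψ) : WeightSpace) = modulation (-(2 * Real.pi * a)) (𝓕 ψ : WeightSpace) := by
  have hdisp : Integrable (displacement a ψ) :=
    (integrable_congr (coeFn_displacement a ψ)).2 (hψ.comp_sub_right a)
  refine Lp.ext ?_
  filter_upwards [coeFn_fourier_ae_eq_of_integrable _ hdisp,
    coeFn_modulation (-(2 * Real.pi * a)) (𝓕 ψ : WeightSpace),
    coeFn_fourier_ae_eq_of_integrable ψ hψ] with τ hL hR hF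
  have htranslate := congrFun (VectorFourier.fourierIntegral_comp_add_right Real.fourierChar
    volume (innerₗ ℝ) (ψ : ℝ → ℂ) (-a)) τ
  rw [hL, hR, hF, Real.fourier_congr_ae (coeFn_displacement a ψ)]
  refine htranslate.trans ?_
  rw [Circle.smul_def, Real.fourierChar_apply, smul_eq_mul, innerₗ_apply_apply, Real.inner_apply]
  congr 2
  push_cast
  ring

theorem fourier_displacement (a : ℝ) (ψ : WeightSpace) :
    (𝓕 (displacement a ψ) : WeightSpace) = modulation (-(2 * Real.pi * a)) (𝓕 ψ : WeightSpace) := by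
  have hF : Continuous fun φ : WeightSpace => (𝓕 φ : WeightSpace) :=
    (Lp.fourierTransformₗᵢ ℝ ℂ).continuous
  have hdense : DenseRange (SchwartzMap.toLpCLM ℝ ℂ 2 (volume : Measure ℝ)) :=
    SchwartzMap.denseRange_toLpCLM ENNReal.ofNat_ne_top
  refine congrFun (hdense.equalizer (hF.comp (displacement a).continuous)
    ((modulation _).continuous.comp hF) (funext fun f => ?_)) ψ
  exact fourier_displacement_of_integrable
    ((integrable_congr (f.coeFn_toLp 2 volume)).2 f.integrable) a

/-- The real-bilinear map `(x, y) ↦ x · conj y` on `ℂ`. -/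
def mulConj : ℂ →L[ℝ] ℂ →L[ℝ] ℂ :=
  (ContinuousLinearMap.mul ℝ ℂ).bilinearComp (ContinuousLinearMap.id ℝ ℂ)
    (Complex.conjCLE : ℂ →L[ℝ] ℂ)

theorem norm_mulConj_le : ‖mulConj‖ ≤ 1 :=
  ContinuousLinearMap.opNorm_le_bound₂ _ zero_le_one fun x y => by simp [mulConj]

/-- The product `𝓕 φ · conj (𝓕 ψ)`, as a continuous real-bilinear map from `L²` to `L¹`. -/
def fourierPairing : WeightSpace →L[ℝ] WeightSpace →L[ℝ] Lp ℂ 1 (volume : Measure ℝ) :=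
  (mulConj.holderL volume 2 2 1).bilinearComp
    ((Lp.fourierTransformₗᵢ ℝ ℂ : WeightSpace →L[ℂ] WeightSpace).restrictScalars ℝ)
    ((Lp.fourierTransformₗᵢ ℝ ℂ : WeightSpace →L[ℂ] WeightSpace).restrictScalars ℝ)

theorem coeFn_fourierPairing (φ ψ : WeightSpace) : fourierPairing φ ψ =ᵐ[volume]
    fun τ => (𝓕 φ : WeightSpace) τ * conj ((𝓕 ψ : WeightSpace) τ) :=
  mulConj.coeFn_holder (𝓕 φ : WeightSpace) (𝓕 ψ : WeightSpace)

theorem norm_fourierPairing_le (φ ψ : WeightSpace) : ‖fourierPairing φ ψ‖ ≤ ‖φ‖ * ‖ψ‖ := by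
  refine (mulConj.norm_holder_apply_apply_le (𝓕 φ : WeightSpace) (𝓕 ψ : WeightSpace)).trans ?_
  rw [Lp.norm_fourier_eq, Lp.norm_fourier_eq, mul_assoc]
  exact mul_le_of_le_one_left (by positivity) norm_mulConj_le

/-- The value at `ω` of the Fourier transform of an integrable function, as a continuous linear
functional on `L¹`. -/
def fourierCoeff (ω : ℝ) : Lp ℂ 1 (volume : Measure ℝ) →L[ℂ] ℂ :=
  BoundedContinuousFunction.evalCLM ℂ ω ∘L Real.Lp.fourierTransformCLM ℝ ℂ

theorem fourierCoeff_apply (ω : ℝ) (G : Lp ℂ 1 (volume : Measure ℝ)) :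
    fourierCoeff ω G = ∫ τ : ℝ, Complex.exp (Complex.I * τ * (-(2 * Real.pi * ω) : ℝ)) * G τ := by
  refine (Real.fourier_real_eq_integral_exp_smul (G : ℝ → ℂ) ω).trans ?_
  congr 1 with τ
  rw [smul_eq_mul]
  congr 2
  push_cast
  ring

theorem fourierCoeff_fourierPairing (ω : ℝ) (φ ψ : WeightSpace) :
    fourierCoeff ω (fourierPairing φ ψ) = inner ℂ ψ (displacement ω φ) := by
  rw [← Lp.inner_fourier_eq, fourier_displacement, L2.inner_def, fourierCoeff_apply]
  refine integral_congr_ae ?_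
  filter_upwards [coeFn_fourierPairing φ ψ,
    coeFn_modulation (-(2 * Real.pi * ω)) (𝓕 φ : WeightSpace)] with τ hpair hmod
  rw [hpair, hmod, RCLike.inner_apply]
  ring

/-! ### Center-of-mass coordinates -/

section CenterOfMass

theorem measurePreserving_sub_half_add_half :
    MeasurePreserving (fun z : ℝ × ℝ => (z.1 - z.2 / 2, z.1 + z.2 / 2)) := by
  have hcenter : MeasurePreserving (fun z : ℝ × ℝ => (z.1, z.2 - z.1 / 2))
      (volume.prod volume) (volume.prod volume) :=
    (MeasurePreserving.id volume).skew_product (g := fun ω E => E - ω / 2)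
      (by simp only [Function.uncurry_def]; fun_prop)
      (Eventually.of_forall fun ω => (measurePreserving_sub_right volume (ω / 2)).map_eq)
  have hshear : MeasurePreserving (fun z : ℝ × ℝ => (z.1, z.2 + z.1))
      (volume.prod volume) (volume.prod volume) :=
    (MeasurePreserving.id volume).skew_product (g := fun x ω => ω + x)
      (by simp only [Function.uncurry_def]; fun_prop)
      (Eventually.of_forall fun x => (measurePreserving_add_right volume x).map_eq)
  have hswap : MeasurePreserving (Prod.swap : ℝ × ℝ → ℝ × ℝ) (volume.prod volume)
    (volume.prod volume) := Measure.measurePreserving_swap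
  rw [Measure.volume_eq_prod]
  convert hshear.comp (hswap.comp (hcenter.comp hswap)) using 1
  funext z
  simp only [Function.comp_apply, Prod.swap, Prod.mk.injEq, true_and]
  ring

theorem ae_sub_half_and_add_half {P : ℝ → Prop} (hP : ∀ᵐ x, P x) :
    ∀ᵐ z : ℝ × ℝ, P (z.1 - z.2 / 2) ∧ P (z.1 + z.2 / 2) := by
  have hq := measurePreserving_sub_half_add_half.quasiMeasurePreserving
  exact ((Measure.quasiMeasurePreserving_fst.comp hq).ae hP).and
    ((Measure.quasiMeasurePreserving_snd.comp hq).ae hP)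

theorem integrable_mul_sub_half_add_half {𝕜 : Type*} [RCLike 𝕜] {a b : ℝ → 𝕜}
    (ha : Integrable a) (hb : Integrable b) :
    Integrable fun z : ℝ × ℝ => a (z.1 - z.2 / 2) * b (z.1 + z.2 / 2) :=
  measurePreserving_sub_half_add_half.integrable_comp_of_integrable
    (g := fun z : ℝ × ℝ => a z.1 * b z.2) (ha.mul_prod hb)

theorem integral_mul_sub_half_add_half {𝕜 : Type*} [RCLike 𝕜] {a b : ℝ → 𝕜}
    (ha : Integrable a) (hb : Integrable b) :
    ∫ z : ℝ × ℝ, a (z.1 - z.2 / 2) * b (z.1 + z.2 / 2) = (∫ x, a x) * ∫ x, b x := by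
  have hm := measurePreserving_sub_half_add_half
  have h := integral_map (f := fun z : ℝ × ℝ => a z.1 * b z.2) hm.measurable.aemeasurable
    (by rw [hm.map_eq]; exact (ha.mul_prod hb).aestronglyMeasurable)
  rw [hm.map_eq] at h
  rw [← integral_prod_mul a b]
  exact h.symm

variable {𝕜 ι : Type*} [RCLike 𝕜] {a b : ι → ℝ → 𝕜} (ha : ∀ k, Integrable (a k))
  (hb : ∀ k, Integrable (b k)) (hab : Summable fun k => (∫ x, ‖a k x‖) * ∫ x, ‖b k x‖)
include ha hb hab

theorem summable_integral_norm_mul_sub_half_add_half :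
    Summable fun k => ∫ z : ℝ × ℝ, ‖a k (z.1 - z.2 / 2) * b k (z.1 + z.2 / 2)‖ := by
  simpa only [norm_mul, fun k => integral_mul_sub_half_add_half (ha k).norm (hb k).norm] using hab

variable [Countable ι]

theorem integrable_tsum_mul_sub_half_add_half :
    Integrable fun z : ℝ × ℝ => ∑' k, a k (z.1 - z.2 / 2) * b k (z.1 + z.2 / 2) :=
  integrable_tsum_of_summable_integral_norm
    (fun k => integrable_mul_sub_half_add_half (ha k) (hb k))
    (summable_integral_norm_mul_sub_half_add_half ha hb hab)

theorem integral_tsum_mul_sub_half_add_half :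
    ∫ z : ℝ × ℝ, ∑' k, a k (z.1 - z.2 / 2) * b k (z.1 + z.2 / 2) =
      ∑' k, (∫ x, a k x) * ∫ x, b k x := by
  rw [← integral_tsum_of_summable_integral_norm
    (fun k => integrable_mul_sub_half_add_half (ha k) (hb k))
    (summable_integral_norm_mul_sub_half_add_half ha hb hab)]
  exact tsum_congr fun k => integral_mul_sub_half_add_half (ha k) (hb k)

end CenterOfMass

/-! ### The Wigner function -/

section IntegrableAmplitudes

theorem integrable_and_sq_integral_norm_le_of_mem_domain {ψ : WeightSpace}
    (hψ : ψ ∈ weightH.domain) :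
    Integrable ψ ∧ (∫ E, ‖ψ E‖) ^ 2 ≤ Real.pi * (‖ψ‖ ^ 2 + ‖app weightH ψ‖ ^ 2) := by
  have hEψ : ⇑(app weightH ψ) =ᵐ[volume] fun E : ℝ => E • ψ E := by
    rw [weightH] at hψ ⊢
    simpa only [Complex.real_smul] using coeFn_app_mulOp hψ
  have h := integrable_and_sq_integral_norm_le (Lp.memLp ψ) ((memLp_congr_ae hEψ).1 (Lp.memLp _))
  have hnorm : ∫ E, ‖app weightH ψ E‖ ^ 2 = ∫ E, ‖E • ψ E‖ ^ 2 :=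
    integral_congr_ae (hEψ.mono fun E hE => by simp only [hE])
  rwa [norm_sq_eq_integral_norm_sq, norm_sq_eq_integral_norm_sq, hnorm]

theorem integrable_modulation {ψ : WeightSpace} (hψ : Integrable ψ) (s : ℝ) :
    Integrable (modulation s ψ) :=
  (hψ.bdd_mul (c := 1) (by fun_prop)
    (Eventually.of_forall fun E => (norm_exp_I_mul E s).le)).congr (coeFn_modulation s ψ).symm

theorem integral_norm_modulation (s : ℝ) (ψ : WeightSpace) :
    ∫ E, ‖modulation s ψ E‖ = ∫ E, ‖ψ E‖ :=
  integral_congr_ae ((coeFn_modulation s ψ).mono fun E hE => by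
    simp only [hE, norm_mul, norm_exp_I_mul, one_mul])

variable {ι : Type*} {ρW : MixedState ι WeightSpace} (hρW : ρW.FiniteSecondMoment weightH)
include hρW

theorem integrable_modulation_amplitude (s : ℝ) (k : ι) :
    Integrable (modulation s (ρW.amplitude k)) :=
  integrable_modulation (integrable_and_sq_integral_norm_le_of_mem_domain (hρW.mem k)).1 s

theorem summable_sq_integral_norm_amplitude :
    Summable fun k => (∫ E, ‖ρW.amplitude k E‖) ^ 2 :=
  Summable.of_nonneg_of_le (fun _ => sq_nonneg _)
    (fun k => (integrable_and_sq_integral_norm_le_of_mem_domain (hρW.mem k)).2)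
    ((ρW.hasSum_norm_sq_amplitude.summable.add hρW.summable).mul_left _)

theorem summable_integral_norm_modulation_mul (r s : ℝ) :
    Summable fun k => (∫ E, ‖modulation r (ρW.amplitude k) E‖) *
      ∫ E, ‖conj (modulation s (ρW.amplitude k) E)‖ := by
  simpa only [RCLike.norm_conj, integral_norm_modulation, ← sq] using
    summable_sq_integral_norm_amplitude hρW

end IntegrableAmplitudes

section Wigner

variable {ι : Type*}

theorem coeFn_modulation_amplitude (ρW : MixedState ι WeightSpace) (s : ℝ) (k : ι) :
    modulation s (ρW.amplitude k) =ᵐ[volume] fun E : ℝ =>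
      Complex.exp (Complex.I * E * s) * ((√(ρW.p k) : ℂ) * ρW.ψ k E) := by
  filter_upwards [coeFn_modulation s (ρW.amplitude k),
    Lp.coeFn_smul (√(ρW.p k) : ℂ) (ρW.ψ k)] with E hmod hsmul
  rw [hmod, MixedState.amplitude, hsmul, Pi.smul_apply, smul_eq_mul]

theorem exp_mul_exp_eq_mul_conj (E ω s t : ℝ) :
    Complex.exp (Complex.I * E * s) * Complex.exp (Complex.I * ω * t) =
      Complex.exp (Complex.I * (E - ω / 2 : ℝ) * (s / 2 - t : ℝ)) *
        conj (Complex.exp (Complex.I * (E + ω / 2 : ℝ) * (-s / 2 - t : ℝ))) := by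
  simp only [← Complex.exp_conj, ← Complex.exp_add, map_mul, Complex.conj_I, Complex.conj_ofReal]
  congr 1
  push_cast
  ring

/-- The characteristic transform `∫ dE e^{iEs} W(E,t)` of the Wigner function at time `t`. -/
def wignerTransform (ρW : MixedState ι WeightSpace) (s t : ℝ) : ℂ :=
  ∫ E : ℝ, Complex.exp (Complex.I * E * s) * wigner ρW E t

variable [Countable ι]

theorem exp_mul_kernel_ae_eq (ρW : MixedState ι WeightSpace) (s t : ℝ) :
    (fun z : ℝ × ℝ => Complex.exp (Complex.I * z.1 * s) *
        (Complex.exp (Complex.I * z.2 * t) * kernel ρW (z.1 - z.2 / 2) (z.1 + z.2 / 2))) =ᵐ[volume]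
      fun z => ∑' k, modulation (s / 2 - t) (ρW.amplitude k) (z.1 - z.2 / 2) *
        conj (modulation (-s / 2 - t) (ρW.amplitude k) (z.1 + z.2 / 2)) := by
  filter_upwards [
    ae_sub_half_and_add_half (ae_all_iff.2 (coeFn_modulation_amplitude ρW (s / 2 - t))),
    ae_sub_half_and_add_half (ae_all_iff.2 (coeFn_modulation_amplitude ρW (-s / 2 - t)))]
    with z hleft hright
  rw [← mul_assoc, exp_mul_exp_eq_mul_conj, kernel, ← tsum_mul_left]
  refine tsum_congr fun k => ?_
  rw [hleft.1 k, hright.2 k, ← ρW.sqrt_p_mul_self k]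
  simp only [map_mul, Complex.conj_ofReal]
  ring

variable {ρW : MixedState ι WeightSpace} (hρW : ρW.FiniteSecondMoment weightH)
include hρW

theorem integrable_exp_mul_kernel (s t : ℝ) :
    Integrable fun z : ℝ × ℝ => Complex.exp (Complex.I * z.1 * s) *
      (Complex.exp (Complex.I * z.2 * t) * kernel ρW (z.1 - z.2 / 2) (z.1 + z.2 / 2)) :=
  (integrable_tsum_mul_sub_half_add_half (integrable_modulation_amplitude hρW _)
    (fun k => Complex.conjCLE.toContinuousLinearMap.integrable_comp
      (integrable_modulation_amplitude hρW _ k))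
    (summable_integral_norm_modulation_mul hρW _ _)).congr (exp_mul_kernel_ae_eq ρW s t).symm

theorem integral_exp_mul_kernel (s t : ℝ) :
    ∫ z : ℝ × ℝ, Complex.exp (Complex.I * z.1 * s) *
        (Complex.exp (Complex.I * z.2 * t) * kernel ρW (z.1 - z.2 / 2) (z.1 + z.2 / 2)) =
      ∑' k, (∫ E, modulation (s / 2 - t) (ρW.amplitude k) E) *
        conj (∫ E, modulation (-s / 2 - t) (ρW.amplitude k) E) := by
  rw [integral_congr_ae (exp_mul_kernel_ae_eq ρW s t)]
  simp only [← integral_conj]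
  exact integral_tsum_mul_sub_half_add_half (integrable_modulation_amplitude hρW _)
    (fun k => Complex.conjCLE.toContinuousLinearMap.integrable_comp
      (integrable_modulation_amplitude hρW _ k))
    (summable_integral_norm_modulation_mul hρW _ _)

theorem integrable_wigner (t : ℝ) : Integrable fun E => wigner ρW E t := by
  simpa [wigner] using (integrable_exp_mul_kernel hρW 0 t).integral_prod_left.const_mul
    (1 / (2 * Real.pi) : ℂ)

theorem wignerTransform_eq_tsum (s t : ℝ) :
    wignerTransform ρW s t = (1 / (2 * Real.pi) : ℂ) *
      ∑' k, (∫ E, modulation (s / 2 - t) (ρW.amplitude k) E) *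
        conj (∫ E, modulation (-s / 2 - t) (ρW.amplitude k) E) := by
  rw [← integral_exp_mul_kernel hρW, Measure.volume_eq_prod,
    integral_prod _ (integrable_exp_mul_kernel hρW s t), ← integral_const_mul]
  refine integral_congr_ae (Eventually.of_forall fun E => ?_)
  simp only [wigner, integral_const_mul]
  ring

end Wigner

/-! ### The Wigner function as a curve in `L¹` -/

section Rescaling

theorem ae_comp_mul_left {P : ℝ → Prop} (hP : ∀ᵐ t, P t) {c : ℝ} (hc : c ≠ 0) :
    ∀ᵐ τ, P (c * τ) := by
  have hq : Measure.QuasiMeasurePreserving (fun τ : ℝ => c * τ) volume volume := by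
    refine ⟨by fun_prop, ?_⟩
    rw [Real.map_volume_mul_left hc]
    exact Measure.smul_absolutelyContinuous
  exact hq.ae hP

variable {g : ℝ → ℂ} {G : Lp ℂ 1 (volume : Measure ℝ)}

theorem integrable_of_coeFn_ae_eq_two_pi_mul
    (hG : G =ᵐ[volume] fun τ => (2 * Real.pi : ℂ) * g (2 * Real.pi * τ)) : Integrable g := by
  rw [← integrable_comp_mul_left_iff _ Real.two_pi_pos.ne']
  have h2π : IsUnit (2 * Real.pi : ℂ) :=
    isUnit_iff_ne_zero.2 (by exact_mod_cast Real.two_pi_pos.ne')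
  exact (integrable_const_mul_iff h2π _).1 ((L1.integrable_coeFn G).congr hG)

theorem fourierCoeff_eq_of_coeFn_ae_eq_two_pi_mul
    (hG : G =ᵐ[volume] fun τ => (2 * Real.pi : ℂ) * g (2 * Real.pi * τ)) (ω : ℝ) :
    fourierCoeff ω G = ∫ t : ℝ, Complex.exp (Complex.I * (-ω : ℝ) * t) * g t := by
  have hscale := Measure.integral_comp_mul_left
    (fun t : ℝ => Complex.exp (Complex.I * (-ω : ℝ) * t) * g t) (2 * Real.pi)
  rw [abs_of_pos (inv_pos.2 Real.two_pi_pos), eq_inv_smul_iff₀ Real.two_pi_pos.ne',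
    ← integral_smul] at hscale
  rw [← hscale, fourierCoeff_apply]
  refine integral_congr_ae ?_
  filter_upwards [hG] with τ hτ
  have hphase : Complex.I * τ * (-(2 * Real.pi * ω) : ℝ) =
      Complex.I * (-ω : ℝ) * (2 * Real.pi * τ : ℝ) := by
    push_cast
    ring
  rw [hτ, hphase, Complex.real_smul]
  push_cast
  ring

end Rescaling

section PureCurve

/-- The curve `s ↦ (τ ↦ 2π ∫ dE e^{iEs} W(E, 2πτ))` in `L¹`, where `W` is the Wigner function of
the vector `ψ`. The phase is split evenly between the two factors of `|ψ⟩⟨ψ|`. -/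
def pureWignerCurve (ψ : WeightSpace) (s : ℝ) : Lp ℂ 1 (volume : Measure ℝ) :=
  fourierPairing (modulation (s / 2) ψ) (modulation (-s / 2) ψ)

/-- The derivative of `pureWignerCurve ψ` at `s`. -/
def pureWignerCurveDeriv (ψ : WeightSpace) (s : ℝ) : Lp ℂ 1 (volume : Measure ℝ) :=
  fourierPairing ((1 / 2 : ℝ) • Complex.I • modulation (s / 2) (app weightH ψ))
      (modulation (-s / 2) ψ) +
    fourierPairing (modulation (s / 2) ψ)
      ((-1 / 2 : ℝ) • Complex.I • modulation (-s / 2) (app weightH ψ))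

theorem norm_pureWignerCurve_le (ψ : WeightSpace) (s : ℝ) : ‖pureWignerCurve ψ s‖ ≤ ‖ψ‖ ^ 2 := by
  simpa only [pureWignerCurve, LinearIsometry.norm_map, ← sq] using
    norm_fourierPairing_le (modulation (s / 2) ψ) (modulation (-s / 2) ψ)

theorem norm_pureWignerCurveDeriv_le (ψ : WeightSpace) (s : ℝ) :
    ‖pureWignerCurveDeriv ψ s‖ ≤ ‖ψ‖ * ‖app weightH ψ‖ := by
  refine (norm_add_le _ _).trans
    ((add_le_add (norm_fourierPairing_le _ _) (norm_fourierPairing_le _ _)).trans_eq ?_)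
  simp only [norm_smul, LinearIsometry.norm_map, Complex.norm_I, Real.norm_eq_abs, abs_div,
    abs_neg, abs_one, abs_two]
  ring

theorem hasDerivAt_pureWignerCurve {ψ : WeightSpace} (hψ : ψ ∈ weightH.domain) (s : ℝ) :
    HasDerivAt (pureWignerCurve ψ) (pureWignerCurveDeriv ψ s) s := by
  have hleft := HasDerivAt.scomp s (hasDerivAt_modulation hψ (s / 2))
    ((hasDerivAt_id s).div_const 2)
  have hright := HasDerivAt.scomp s (hasDerivAt_modulation hψ (-s / 2))
    ((hasDerivAt_id s).neg.div_const 2)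
  exact (fourierPairing.hasFDerivAt.comp_hasDerivAt s hleft).clm_apply hright

theorem coeFn_fourier_modulation {ψ : WeightSpace} (hψ : Integrable ψ) (r : ℝ) :
    ⇑(𝓕 (modulation r ψ) : WeightSpace) =ᵐ[volume]
      fun τ => ∫ E, modulation (r - 2 * Real.pi * τ) ψ E := by
  filter_upwards [coeFn_fourier_ae_eq_of_integrable _ (integrable_modulation hψ r)] with τ hτ
  rw [hτ, Real.fourier_real_eq_integral_exp_smul]
  refine integral_congr_ae ?_
  filter_upwards [coeFn_modulation r ψ, coeFn_modulation (r - 2 * Real.pi * τ) ψ] with E hr hrτ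
  rw [hr, hrτ, smul_eq_mul, ← mul_assoc, ← Complex.exp_add]
  congr 2
  push_cast
  ring

theorem coeFn_pureWignerCurve {ψ : WeightSpace} (hψ : Integrable ψ) (s : ℝ) :
    pureWignerCurve ψ s =ᵐ[volume] fun τ => (∫ E, modulation (s / 2 - 2 * Real.pi * τ) ψ E) *
      conj (∫ E, modulation (-s / 2 - 2 * Real.pi * τ) ψ E) := by
  filter_upwards [coeFn_fourierPairing (modulation (s / 2) ψ) (modulation (-s / 2) ψ),
    coeFn_fourier_modulation hψ (s / 2), coeFn_fourier_modulation hψ (-s / 2)]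
    with τ hpair hleft hright
  rw [pureWignerCurve, hpair, hleft, hright]

theorem fourierCoeff_pureWignerCurveDeriv_zero (ω : ℝ) (ψ : WeightSpace) :
    fourierCoeff ω (pureWignerCurveDeriv ψ 0) = Complex.I * (1 / 2 *
      (inner ℂ (app weightH ψ) (displacement ω ψ) +
        inner ℂ ψ (displacement ω (app weightH ψ)))) := by
  simp only [pureWignerCurveDeriv, zero_div, neg_zero, modulation_zero, map_add,
    fourierCoeff_fourierPairing, ← algebraMap_smul ℂ (_ : ℝ)]
  simp only [map_smul, inner_smul_left, inner_smul_right, Complex.coe_algebraMap,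
    Complex.conj_ofReal, Complex.conj_I]
  push_cast
  ring

end PureCurve

section MixedCurve

variable {ι : Type*}

/-- The curve `s ↦ (τ ↦ 2π ∫ dE e^{iEs} W(E, 2πτ))` in `L¹`. -/
def wignerCurve (ρW : MixedState ι WeightSpace) (s : ℝ) : Lp ℂ 1 (volume : Measure ℝ) :=
  ∑' k, pureWignerCurve (ρW.amplitude k) s

/-- The derivative of `wignerCurve` at `0`. -/
def wignerCurveDeriv (ρW : MixedState ι WeightSpace) : Lp ℂ 1 (volume : Measure ℝ) :=
  ∑' k, pureWignerCurveDeriv (ρW.amplitude k) 0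

theorem summable_norm_pureWignerCurve (ρW : MixedState ι WeightSpace) (s : ℝ) :
    Summable fun k => ‖pureWignerCurve (ρW.amplitude k) s‖ :=
  Summable.of_nonneg_of_le (fun _ => norm_nonneg _) (fun _ => norm_pureWignerCurve_le _ s)
    ρW.hasSum_norm_sq_amplitude.summable

theorem fourierCoeff_wignerCurve (ρW : MixedState ι WeightSpace) (ω s : ℝ) :
    fourierCoeff ω (wignerCurve ρW s) = ∑' k, inner ℂ (modulation (-s / 2) (ρW.amplitude k))
      (displacement ω (modulation (s / 2) (ρW.amplitude k))) := by
  rw [wignerCurve, (fourierCoeff ω).map_tsum (summable_norm_pureWignerCurve ρW s).of_norm]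
  exact tsum_congr fun k => fourierCoeff_fourierPairing ω _ _

theorem fourierCoeff_wignerCurve_zero (ρW : MixedState ι WeightSpace) (ω : ℝ) :
    fourierCoeff ω (wignerCurve ρW 0) = displacementMean ρW ω := by
  simp only [fourierCoeff_wignerCurve, zero_div, neg_zero, modulation_zero, displacementMean]

theorem fourierCoeff_zero_wignerCurve (ρW : MixedState ι WeightSpace) (s : ℝ) :
    fourierCoeff 0 (wignerCurve ρW s) =
      ρW.expect (mulOp fun E => Complex.exp (Complex.I * E * s)) := by
  rw [fourierCoeff_wignerCurve, MixedState.expect_eq_tsum]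
  refine tsum_congr fun k => ?_
  rw [displacement_zero, inner_modulation_modulation, app_mulOp_exp, neg_div, sub_neg_eq_add,
    add_halves]

variable {ρW : MixedState ι WeightSpace} (hρW : ρW.FiniteSecondMoment weightH)
include hρW

theorem summable_norm_amplitude_mul_norm_weightH :
    Summable fun k => ‖ρW.amplitude k‖ * ‖app weightH (ρW.amplitude k)‖ :=
  Summable.of_nonneg_of_le (fun _ => by positivity)
    (fun k => (le_mul_of_one_le_left (by positivity) one_le_two).trans
      ((mul_assoc _ _ _).symm.trans_le (two_mul_le_add_sq _ _)))
    (ρW.hasSum_norm_sq_amplitude.summable.add hρW.summable)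

theorem hasDerivAt_wignerCurve : HasDerivAt (wignerCurve ρW) (wignerCurveDeriv ρW) 0 :=
  hasDerivAt_tsum (summable_norm_amplitude_mul_norm_weightH hρW)
    (fun k s => hasDerivAt_pureWignerCurve (hρW.mem k) s)
    (fun k s => norm_pureWignerCurveDeriv_le (ρW.amplitude k) s)
    (summable_norm_pureWignerCurve ρW 0).of_norm 0

theorem fourierCoeff_wignerCurveDeriv (ω : ℝ) :
    fourierCoeff ω (wignerCurveDeriv ρW) = Complex.I * energyDisplacementMean ρW ω := by
  have hsum : Summable fun k => pureWignerCurveDeriv (ρW.amplitude k) 0 :=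
    Summable.of_norm_bounded (summable_norm_amplitude_mul_norm_weightH hρW)
      fun k => norm_pureWignerCurveDeriv_le _ 0
  have hleft : Summable fun k =>
      inner ℂ (app weightH (ρW.amplitude k)) (displacement ω (ρW.amplitude k)) :=
    summable_inner_of_summable_norm_sq hρW.summable
      (by simpa only [LinearIsometryEquiv.norm_map] using ρW.hasSum_norm_sq_amplitude.summable)
  have hright : Summable fun k =>
      inner ℂ (ρW.amplitude k) (displacement ω (app weightH (ρW.amplitude k))) :=
    summable_inner_of_summable_norm_sq ρW.hasSum_norm_sq_amplitude.summable
      (by simpa only [LinearIsometryEquiv.norm_map] using hρW.summable)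
  rw [wignerCurveDeriv, (fourierCoeff ω).map_tsum hsum, energyDisplacementMean,
    ← hleft.tsum_add hright, ← tsum_mul_left, ← tsum_mul_left]
  exact tsum_congr fun k => fourierCoeff_pureWignerCurveDeriv_zero ω _

theorem hasDerivAt_fourierCoeff_wignerCurve (ω : ℝ) :
    HasDerivAt (fun s => fourierCoeff ω (wignerCurve ρW s))
      (Complex.I * energyDisplacementMean ρW ω) 0 := by
  rw [← fourierCoeff_wignerCurveDeriv hρW]
  exact ((fourierCoeff ω).restrictScalars ℝ).hasFDerivAt.comp_hasDerivAt 0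
    (hasDerivAt_wignerCurve hρW)

variable [Countable ι]

theorem coeFn_wignerCurve (s : ℝ) : wignerCurve ρW s =ᵐ[volume]
    fun τ => (2 * Real.pi : ℂ) * wignerTransform ρW s (2 * Real.pi * τ) := by
  have htop : ∑' k, ‖pureWignerCurve (ρW.amplitude k) s‖ₑ ≠ ⊤ := by
    simp only [← ofReal_norm]
    exact (summable_norm_pureWignerCurve ρW s).tsum_ofReal_ne_top
  filter_upwards [Lp.coeFn_tsum htop, ae_all_iff.2 fun k => coeFn_pureWignerCurve
    (integrable_and_sq_integral_norm_le_of_mem_domain (hρW.mem k)).1 s] with τ hsum hterm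
  rw [wignerCurve, hsum, wignerTransform_eq_tsum hρW, tsum_congr hterm, ← mul_assoc,
    mul_one_div_cancel (by exact_mod_cast Real.two_pi_pos.ne'), one_mul]

theorem integrable_wignerTransform (s : ℝ) : Integrable (wignerTransform ρW s) :=
  integrable_of_coeFn_ae_eq_two_pi_mul (coeFn_wignerCurve hρW s)

theorem hasDerivAt_wignerTransform {t : ℝ}
    (hE : Integrable fun E : ℝ => (E : ℂ) * wigner ρW E t) :
    HasDerivAt (fun s => wignerTransform ρW s t)
      (Complex.I * ∫ E : ℝ, (E : ℂ) * wigner ρW E t) 0 := by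
  have hW := integrable_wigner hρW t
  have hexp : ∀ s : ℝ, AEStronglyMeasurable (fun E : ℝ => Complex.exp (Complex.I * E * s))
    volume := fun s => by fun_prop
  have hderiv := (hasDerivAt_integral_of_dominated_loc_of_deriv_le (x₀ := (0 : ℝ))
    (F := fun (s : ℝ) (E : ℝ) => Complex.exp (Complex.I * E * s) * wigner ρW E t)
    (F' := fun (s : ℝ) (E : ℝ) =>
      Complex.exp (Complex.I * E * s) * (Complex.I * ((E : ℂ) * wigner ρW E t)))
    (bound := fun E : ℝ => ‖(E : ℂ) * wigner ρW E t‖) univ_mem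
    (Eventually.of_forall fun s => (hexp s).mul hW.aestronglyMeasurable)
    (by simpa using hW) ((hexp 0).mul (hE.const_mul Complex.I).aestronglyMeasurable)
    (Eventually.of_forall fun E s _ => by
      rw [norm_mul, norm_exp_I_mul, one_mul, norm_mul, Complex.norm_I, one_mul])
    hE.norm (Eventually.of_forall fun E s _ => by
      simpa only [mul_assoc] using (hasDerivAt_exp_I_mul E s).mul_const (wigner ρW E t))).2
  simp only [Complex.ofReal_zero, mul_zero, Complex.exp_zero, one_mul, integral_const_mul]
    at hderiv
  exact hderiv

theorem coeFn_wignerCurveDeriv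
    (hE : ∀ᵐ t : ℝ, Integrable fun E : ℝ => (E : ℂ) * wigner ρW E t) :
    wignerCurveDeriv ρW =ᵐ[volume] fun τ => (2 * Real.pi : ℂ) *
      (Complex.I * ∫ E : ℝ, (E : ℂ) * wigner ρW E (2 * Real.pi * τ)) :=
  ae_eq_of_hasDerivAt_Lp (coeFn_wignerCurve hρW) (hasDerivAt_wignerCurve hρW)
    ((ae_comp_mul_left hE Real.two_pi_pos.ne').mono fun _ hτ =>
      (hasDerivAt_wignerTransform hρW hτ).const_mul _)

end MixedCurve

/-! ### The centered energy moment of the Wigner function -/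

section CenteredMoment

variable {ι : Type*} [Countable ι] {ρW : MixedState ι WeightSpace}
  (hρW : ρW.FiniteSecondMoment weightH)
include hρW

theorem integrable_mul_wigner_of_integrable_sub_mul {m : ℂ} {t : ℝ}
    (hm : Integrable fun E : ℝ => ((E : ℂ) - m) * wigner ρW E t) :
    Integrable fun E : ℝ => (E : ℂ) * wigner ρW E t := by
  refine (hm.add ((integrable_wigner hρW t).const_mul m)).congr (Eventually.of_forall fun E => ?_)
  simp only [Pi.add_apply]
  ring

theorem integral_sub_mul_wigner {m : ℂ} {t : ℝ}
    (hm : Integrable fun E : ℝ => ((E : ℂ) - m) * wigner ρW E t) :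
    ∫ E : ℝ, ((E : ℂ) - m) * wigner ρW E t =
      (∫ E : ℝ, (E : ℂ) * wigner ρW E t) - m * wignerTransform ρW 0 t := by
  simp only [sub_mul, wignerTransform, Complex.ofReal_zero, mul_zero, Complex.exp_zero, one_mul]
  rw [integral_sub (integrable_mul_wigner_of_integrable_sub_mul hρW hm)
    ((integrable_wigner hρW t).const_mul m), integral_const_mul]

theorem coeFn_neg_I_smul_wignerCurveDeriv_sub {m : ℂ}
    (hm : ∀ᵐ t : ℝ, Integrable fun E : ℝ => ((E : ℂ) - m) * wigner ρW E t) :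
    ⇑((-Complex.I) • wignerCurveDeriv ρW - m • wignerCurve ρW 0) =ᵐ[volume] fun τ =>
      (2 * Real.pi : ℂ) * ∫ E : ℝ, ((E : ℂ) - m) * wigner ρW E (2 * Real.pi * τ) := by
  filter_upwards [coeFn_wignerCurveDeriv hρW
      (hm.mono fun _ ht => integrable_mul_wigner_of_integrable_sub_mul hρW ht),
    coeFn_wignerCurve hρW 0, ae_comp_mul_left hm Real.two_pi_pos.ne',
    Lp.coeFn_sub ((-Complex.I) • wignerCurveDeriv ρW) (m • wignerCurve ρW 0),
    Lp.coeFn_smul (-Complex.I) (wignerCurveDeriv ρW), Lp.coeFn_smul m (wignerCurve ρW 0)]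
    with τ hderiv hcurve hmτ hsub hsmul_deriv hsmul_curve
  rw [hsub, Pi.sub_apply, hsmul_deriv, hsmul_curve, Pi.smul_apply, Pi.smul_apply, hderiv, hcurve,
    integral_sub_mul_wigner hρW hmτ, smul_eq_mul, smul_eq_mul]
  linear_combination (-(2 * Real.pi * ∫ E : ℝ, (E : ℂ) * wigner ρW E (2 * Real.pi * τ))) *
    Complex.I_mul_I

theorem integrable_integral_sub_mul_wigner {m : ℂ}
    (hm : ∀ᵐ t : ℝ, Integrable fun E : ℝ => ((E : ℂ) - m) * wigner ρW E t) :
    Integrable fun t => ∫ E : ℝ, ((E : ℂ) - m) * wigner ρW E t :=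
  integrable_of_coeFn_ae_eq_two_pi_mul (coeFn_neg_I_smul_wignerCurveDeriv_sub hρW hm)

theorem integral_exp_mul_integral_sub_mul_wigner
    (hm : ∀ᵐ t : ℝ, Integrable fun E : ℝ =>
      ((E : ℂ) - ρW.expect weightH) * wigner ρW E t) (ω : ℝ) :
    ∫ t : ℝ, Complex.exp (Complex.I * (-ω : ℝ) * t) *
      ∫ E : ℝ, ((E : ℂ) - ρW.expect weightH) * wigner ρW E t = energyDisplacementCov ρW ω := by
  rw [← fourierCoeff_eq_of_coeFn_ae_eq_two_pi_mul
      (coeFn_neg_I_smul_wignerCurveDeriv_sub hρW hm) ω, map_sub, map_smul, map_smul,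
    fourierCoeff_wignerCurveDeriv hρW, fourierCoeff_wignerCurve_zero, energyDisplacementCov,
    smul_eq_mul, smul_eq_mul]
  linear_combination (-energyDisplacementMean ρW ω) * Complex.I_mul_I

end CenteredMoment

/-! ### The two representations of `F` -/

section FreeEvolution

variable {n : Type*} [Fintype n] [DecidableEq n]

theorem freeEvol_eq_diagonal (ε : n → ℝ) (t : ℝ) :
    freeEvol ε t = Matrix.diagonal fun i => Complex.exp (-(Complex.I * ε i * t)) := by
  rw [freeEvol, systemH, ← Matrix.diagonal_smul, Matrix.exp_diagonal]
  congr 1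
  funext i
  rw [Pi.coe_exp, Pi.smul_apply, smul_eq_mul, Complex.exp_eq_exp_ℂ]
  congr 1
  ring

theorem freeEvol_mul_mul_freeEvol_neg_apply (ε : n → ℝ) (M : Matrix n n ℂ) (t : ℝ) (i j : n) :
    (freeEvol ε t * M * freeEvol ε (-t)) i j =
      Complex.exp (Complex.I * (-(ε i - ε j) : ℝ) * t) * M i j := by
  rw [freeEvol_eq_diagonal, freeEvol_eq_diagonal, Matrix.mul_diagonal, Matrix.diagonal_mul,
    mul_right_comm, ← Complex.exp_add]
  congr 2
  push_cast
  ring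

theorem workOpAt_apply (ε : n → ℝ) (V : Matrix n n ℂ) (t : ℝ) (i j : n) :
    workOpAt ε V t i j = Complex.exp (Complex.I * (-(ε j - ε i) : ℝ) * t) * workOp ε V i j := by
  have h := freeEvol_mul_mul_freeEvol_neg_apply ε (workOp ε V) (-t) i j
  rw [neg_neg] at h
  rw [workOpAt, h]
  congr 2
  push_cast
  ring

theorem trace_workOpAt_mul (ε : n → ℝ) (V M : Matrix n n ℂ) (t : ℝ) :
    (workOpAt ε V t * M).trace = ∑ i, ∑ j, workOp ε V i j *
      (M j i * Complex.exp (Complex.I * (-(ε j - ε i) : ℝ) * t)) := by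
  simp only [Matrix.trace, Matrix.diag_apply, Matrix.mul_apply, workOpAt_apply]
  exact Finset.sum_congr rfl fun i _ => Finset.sum_congr rfl fun j _ => by ring

end FreeEvolution

section Representations

variable {n κ ι : Type*} [Fintype n] [DecidableEq n] [Countable ι] (ε : n → ℝ)
  (V : Matrix n n ℂ) (ρS : MixedState κ (EuclideanSpace ℂ n)) {ρW : MixedState ι WeightSpace}
  (hρW : ρW.FiniteSecondMoment weightH)
include hρW

theorem xi_apply (s : ℝ) (i j : n) :
    xi ε ρS ρW s i j = densityMatrix ρS i j *
      (fourierCoeff (ε i - ε j) (wignerCurve ρW s) / fourierCoeff 0 (wignerCurve ρW s)) := by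
  rw [xi, Matrix.of_apply, ← fourierCoeff_zero_wignerCurve,
    fourierCoeff_eq_of_coeFn_ae_eq_two_pi_mul (coeFn_wignerCurve hρW s) (ε i - ε j),
    ← mul_div_assoc, ← integral_const_mul]
  congr 2 with t
  rw [integral_mul_const, freeEvol_mul_mul_freeEvol_neg_apply, wignerTransform]
  ring

theorem hasDerivAt_xi (i j : n) :
    HasDerivAt (fun s => xi ε ρS ρW s i j)
      (Complex.I * (densityMatrix ρS i j * energyDisplacementCov ρW (ε i - ε j))) 0 := by
  have hone : fourierCoeff 0 (wignerCurve ρW 0) = 1 := by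
    rw [fourierCoeff_wignerCurve_zero, displacementMean_zero]
  simp only [xi_apply ε ρS hρW]
  refine (((hasDerivAt_fourierCoeff_wignerCurve hρW (ε i - ε j)).div
    (hasDerivAt_fourierCoeff_wignerCurve hρW 0)
    (hone ▸ one_ne_zero)).const_mul (densityMatrix ρS i j)).congr_deriv ?_
  rw [hone, fourierCoeff_wignerCurve_zero, energyDisplacementMean_zero hρW, energyDisplacementCov]
  ring

theorem fTerm_eq_trace_xiDerivZero :
    fTerm ε V ρS ρW = -Complex.I * (workOp ε V * xiDerivZero ε ρS ρW).trace := by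
  simp only [fTerm_eq_sum ε V ρS hρW, Matrix.trace, Matrix.diag_apply, Matrix.mul_apply,
    xiDerivZero, Matrix.of_apply, (hasDerivAt_xi ε ρS hρW _ _).deriv, Finset.mul_sum]
  refine Finset.sum_congr rfl fun i _ => Finset.sum_congr rfl fun j _ => ?_
  linear_combination (workOp ε V i j * (densityMatrix ρS j i *
    energyDisplacementCov ρW (ε j - ε i))) * Complex.I_mul_I

end Representations

section WignerForm

variable {n : Type*} [Fintype n] [DecidableEq n] (ε : n → ℝ) (V M : Matrix n n ℂ) {g : ℝ → ℂ}
  (hg : Integrable g)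
include hg

theorem integrable_mul_mul_exp_I_mul_mul (a b : ℂ) (ω : ℝ) :
    Integrable fun t : ℝ => a * (b * (Complex.exp (Complex.I * ω * t) * g t)) :=
  ((hg.bdd_mul (c := 1) (by fun_prop)
    (Eventually.of_forall fun t => (norm_exp_I_mul ω t).le)).const_mul b).const_mul a

theorem integrable_trace_workOpAt_mul_mul :
    Integrable fun t : ℝ => (workOpAt ε V t * M).trace * g t := by
  simp only [trace_workOpAt_mul, Finset.sum_mul, mul_assoc (workOp ε V _ _), mul_assoc (M _ _)]
  exact integrable_finsetSum _ fun i _ => integrable_finsetSum _ fun j _ =>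
    integrable_mul_mul_exp_I_mul_mul hg _ _ _

theorem integral_trace_workOpAt_mul_mul :
    ∫ t : ℝ, (workOpAt ε V t * M).trace * g t = ∑ i, ∑ j, workOp ε V i j *
      (M j i * ∫ t : ℝ, Complex.exp (Complex.I * (-(ε j - ε i) : ℝ) * t) * g t) := by
  have hterm : ∀ i j, Integrable fun t : ℝ => workOp ε V i j *
      (M j i * (Complex.exp (Complex.I * (-(ε j - ε i) : ℝ) * t) * g t)) := fun i j =>
    integrable_mul_mul_exp_I_mul_mul hg _ _ _
  simp only [trace_workOpAt_mul, Finset.sum_mul, mul_assoc (workOp ε V _ _), mul_assoc (M _ _)]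
  rw [integral_finsetSum _ fun i _ => integrable_finsetSum _ fun j _ => hterm i j]
  simp only [integral_finsetSum _ fun j _ => hterm _ j, integral_const_mul]

end WignerForm

theorem fTerm_eq_integral_wigner {n κ ι : Type*} [Fintype n] [DecidableEq n] [Countable ι]
    (ε : n → ℝ) (V : Matrix n n ℂ) (ρS : MixedState κ (EuclideanSpace ℂ n))
    {ρW : MixedState ι WeightSpace} (hρW : ρW.FiniteSecondMoment weightH)
    (hE : ∀ᵐ t : ℝ, Integrable fun E : ℝ => ((E : ℂ) - ρW.expect weightH) * wigner ρW E t) :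
    fTerm ε V ρS ρW = ∫ t : ℝ, (workOpAt ε V t * densityMatrix ρS).trace *
      ∫ E : ℝ, ((E : ℂ) - ρW.expect weightH) * wigner ρW E t := by
  simp only [fTerm_eq_sum ε V ρS hρW, integral_trace_workOpAt_mul_mul ε V _
    (integrable_integral_sub_mul_wigner hρW hE), integral_exp_mul_integral_sub_mul_wigner hρW hE]

end QWeight

end

theorem theorem1 {n κ ι : Type*} [Fintype n] [DecidableEq n] [Countable κ] [Countable ι]
    (ε : n → ℝ) (V : Matrix n n ℂ) (hV : V ∈ Matrix.unitaryGroup n ℂ)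
    (ρS : QWeight.MixedState κ (EuclideanSpace ℂ n))
    (ρW : QWeight.MixedState ι QWeight.WeightSpace)
    (hρW : ρW.FiniteSecondMoment QWeight.weightH) :
    -- the observables involved have finite second moments
    ((QWeight.prodState ρS ρW).FiniteSecondMoment (QWeight.onWeight QWeight.weightH) ∧
      (QWeight.prodState ρS ρW).FiniteSecondMoment
        (QWeight.heisenberg (QWeight.totalU ε V) (QWeight.onWeight QWeight.weightH)) ∧
      (QWeight.controlState ε ρS ρW).FiniteSecondMoment
        (QWeight.ofBounded (QWeight.onSystem (QWeight.systemH ε)) -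
          QWeight.onWeight QWeight.weightH)) ∧
    -- the changes of the mean energy and of the energy variance
    QWeight.deltaE ε V ρS ρW =
      QWeight.matExpect (QWeight.controlMarginal ε ρS ρW) (QWeight.workOp ε V) ∧
    QWeight.deltaVar ε V ρS ρW =
      QWeight.matVar (QWeight.controlMarginal ε ρS ρW) (QWeight.workOp ε V) +
        2 * QWeight.fTerm ε V ρS ρW ∧
    -- the integrals that define `ξ_S(s)` converge, and `F = -i Tr[W_S ξ_S'(0)]`
    ((∀ᵐ t : ℝ, Integrable fun E : ℝ => QWeight.wigner ρW E t) ∧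
      (∀ s : ℝ, Integrable fun t : ℝ =>
        ∫ E : ℝ, Complex.exp (Complex.I * E * s) * QWeight.wigner ρW E t) ∧
      (∀ i j, DifferentiableAt ℝ (fun s => QWeight.xi ε ρS ρW s i j) 0) ∧
      QWeight.fTerm ε V ρS ρW =
        -Complex.I * (QWeight.workOp ε V * QWeight.xiDerivZero ε ρS ρW).trace) ∧
    -- the Wigner form of `F`, whenever its inner integral converges for almost every `t`
    ((∀ᵐ t : ℝ, Integrable fun E : ℝ =>
        ((E : ℂ) - (QWeight.prodState ρS ρW).expect (QWeight.onWeight QWeight.weightH)) *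
          QWeight.wigner ρW E t) →
      (Integrable fun t : ℝ =>
        (QWeight.workOpAt ε V t * QWeight.densityMatrix ρS).trace *
          ∫ E : ℝ,
            ((E : ℂ) - (QWeight.prodState ρS ρW).expect (QWeight.onWeight QWeight.weightH)) *
              QWeight.wigner ρW E t) ∧
      QWeight.fTerm ε V ρS ρW =
        ∫ t : ℝ, (QWeight.workOpAt ε V t * QWeight.densityMatrix ρS).trace *
          ∫ E : ℝ,
            ((E : ℂ) - (QWeight.prodState ρS ρW).expect (QWeight.onWeight QWeight.weightH)) *
              QWeight.wigner ρW E t) := by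
  refine ⟨⟨QWeight.finiteSecondMoment_prodState_onWeight ρS hρW,
    QWeight.finiteSecondMoment_heisenberg_totalU ε V ρS hρW hV,
    QWeight.finiteSecondMoment_controlState_systemH_sub_weightH ε ρS hρW⟩,
    QWeight.deltaE_eq_matExpect_workOp ε V ρS hρW hV,
    QWeight.deltaVar_eq_matVar_workOp_add ε V ρS hρW hV,
    ⟨Filter.Eventually.of_forall fun t => QWeight.integrable_wigner hρW t,
      fun s => QWeight.integrable_wignerTransform hρW s,
      fun i j => (QWeight.hasDerivAt_xi ε ρS hρW i j).differentiableAt,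
      QWeight.fTerm_eq_trace_xiDerivZero ε V ρS hρW⟩, fun hE => ?_⟩
  rw [QWeight.expect_prodState_onWeight ρS hρW] at hE ⊢
  exact ⟨QWeight.integrable_trace_workOpAt_mul_mul ε V _
      (QWeight.integrable_integral_sub_mul_wigner hρW hE),
    QWeight.fTerm_eq_integral_wigner ε V ρS hρW hE⟩
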